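/- Setting. Let $L,M>0$. Let $D\subseteq\mathbb R^d$ be an open convex set (the points of interest, for instance $D=\mathbb R^d$), and let $f:\mathbb R^d\to\mathbb R$ be twice differentiable on $D$, with $\nabla f$ $L$-Lipschitz on $D$, $\nabla^2 f$ $M$-Lipschitz on $D$ in the spectral norm, and $f\ge\bar f$ on $D$. Given tolerances $\epsilon_g,\epsilon_H>0$, a starting point $x_0$ and a bound $\alpha$ on the negative-curvature stepsizes, consider the following algorithm. At iteration $k=0,1,2,\dots$ it has an approximate gradient $g_k$, an approximate Hessian $H_k$ (symmetric), and a unit vector $\hat p_k$, with $\hat\lambda_k:=\hat p_k^TH_k\hat p_k$. * If $\|g_k\|>\epsilon_g$, set $x_{k+1}=x_k-\frac1L g_k$. * Otherwise, if $\hat\lambda_k<-\epsilon_H$, choose $\alpha_k\in[\epsilon_H,\min(\alpha,|\hat\lambda_k|)]$, draw $\sigma_k=\pm1$ with probability $\frac12$ each, independently of everything known before the draw (the history up to and including $g_k,H_k,\hat p_k$), and set $x_{k+1}=x_k+\frac{2\alpha_k}{M}\sigma_k\hat p_k$. * Otherwise return $x_k$. The quantities $g_k,H_k,\hat p_k$ may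 depend on the history, but not on $\sigma_k$ or later signs. Almost surely, at every iteration $k$ that is reached, $x_k\in D$ and $$\|g_k-\nabla f(x_k)\|\le\tfrac13\max\{\epsilon_g,\|g_k\|\},$$ and, when $\|g_k\|\le\epsilon_g$ (so that a Hessian is requested), $$\|H_k-\nabla^2f(x_k)\|\le\tfrac29\epsilon_H,\qquad |\hat\lambda_k-\lambda_{\min}(H_k)|\le\tfrac19\epsilon_H .$$ For $\delta\in(0,1)$ and an integer $\eta\ge2$, put $\Delta=f(x_0)-\bar f$, $C_\epsilon=\min\left(\frac{\epsilon_g^2}{6L},\frac{2\epsilon_H^3}{9M^2}\right)$, $B=1+\frac{18\alpha L}{M\epsilon_g}$, $C=2304\frac{M^2\alpha^2\epsilon_g^2}{\epsilon_H^6}$, $$K=\max\left\{C\log\tfrac1\delta,\;4\eta C\left(\tfrac{\Delta}{C_\epsilon}\right)^{1/\eta},\;4\eta^2C^{1+\frac1{\eta-1}}B^{\frac1{\eta-1}}\right\},\qquad n=\frac{2\Delta}{C_\epsilon}+BK .$$ Statement. Let $\epsilon_g=\epsilon>0$, $\epsilon_H=\sqrt{\epsilon M}$ and $\alpha_k=|\hat\lambda_k|$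 at every negative-curvature step. 1. One can take $\alpha=2L$: almost surely, $\alpha_k=|\hat\lambda_k|\in[\epsilon_H,\min(2L,|\hat\lambda_k|)]$ at every negative-curvature step. With $\alpha=2L$ in the definitions above, for all $\delta\in(0,1)$ and all integers $\eta\ge2$ the algorithm terminates within $n$ iterations (it returns at an iteration with index $k<n$) with probability at least $1-\delta$. 2. As $\epsilon\downarrow0$ (with $\alpha = 2L$ and $L,M$ fixed), $B=O(1/\epsilon)$ and $C=O(1/\epsilon)$. 3. For $\eta=11$ and fixed $L,M,\delta$ and fixed $\Delta\ge0$, $K=\tilde O(\epsilon^{-1.2})$ and $n=\tilde O(\epsilon^{-2.2})$ as $\epsilon\downarrow0$, where $F=\tilde O(G)$ means $F=O(G\log^jG)$ for some constant $j\in\mathbb N$. More precisely, for every integer $\eta\ge2$ there is a constant $c>0$ depending only on $L,M,\Delta,\eta$ such that, for all $\epsilon\in(0,1]$ and $\delta\in(0,1)$, $$K\le c\,\left(1+\log\tfrac1\delta\right)\epsilon^{-1-\frac2{\eta-1}},\qquad n\le c\,\left(1+\log\tfrac1\delta\right)\epsilon^{-2-\frac2{\eta-1}} .$$ 4. Larger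 values of $\eta$ bring the bound closer to $\tilde O(\epsilon^{-2})$: for every $\kappa>0$ there is $\eta_0$ such that $n=\tilde O(\epsilon^{-2-\kappa})$ for all $\eta\ge\eta_0$ and all fixed $\delta\in(0,1)$. This is at the expense of a larger constant factor: there are constants $c_\eta$ (depending on $L,M,\Delta,\eta$ only) with $c_\eta\to\infty$ as $\eta\to\infty$ such that, for every $\eta\ge2$ and $\delta\in(0,1)$, $\lim_{\epsilon\downarrow0}n\,\epsilon^{2+\frac2{\eta-1}}=c_\eta$. -/

import Mathlib

open Filter Topology MeasureTheory ProbabilityTheory Asymptotics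

noncomputable section

namespace InexactNC

/-- `ℝ^d` with the Euclidean norm. -/
abbrev E (d : ℕ) : Type := EuclideanSpace ℝ (Fin d)

/-- The Hessian of `f` at `x`, as a linear operator on `ℝ^d` (its norm is the spectral norm). -/
def hessian {d : ℕ} (f : E d → ℝ) (x : E d) : E d →L[ℝ] E d :=
  fderiv ℝ (gradient f) x

/-- The smallest eigenvalue of an operator on `ℝ^d` (used for self-adjoint operators only). -/
def minEigenvalue {d : ℕ} (A : E d →L[ℝ] E d) : ℝ :=
  sInf {μ : ℝ | Module.End.HasEigenvalue (A : E d →ₗ[ℝ] E d) μ}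

/-- On the region `D` of points of interest (an open convex set, for instance all of `ℝ^d`),
`f` is twice differentiable, its gradient is `L`-Lipschitz, its Hessian is `M`-Lipschitz, and
`f` is bounded below by `fbar`. -/
structure BasicAssumption {d : ℕ} (f : E d → ℝ) (D : Set (E d)) (L M fbar : ℝ) : Prop where
  isOpen : IsOpen D
  convex : Convex ℝ D
  differentiableAt : ∀ x ∈ D, DifferentiableAt ℝ f x
  differentiableAt_gradient : ∀ x ∈ D, DifferentiableAt ℝ (gradient f) x
  gradient_lipschitz : ∀ x ∈ D, ∀ y ∈ D, ‖gradient f x - gradient f y‖ ≤ L * ‖x - y‖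
  hessian_lipschitz : ∀ x ∈ D, ∀ y ∈ D, ‖hessian f x - hessian f y‖ ≤ M * ‖x - y‖
  bounded_below : ∀ x ∈ D, fbar ≤ f x

/-- What the algorithm receives at iteration `k`: the approximate gradient `g k`, the
approximate Hessian `H k`, and the approximate eigenvector `p k` of `H k`. All of them are
random: they may depend on the past of the run. -/
structure Oracle (d : ℕ) (Ω : Type*) where
  g : ℕ → Ω → E d
  H : ℕ → Ω → E d →L[ℝ] E d
  p : ℕ → Ω → E d

/-- The approximate smallest eigenvalue `pᵀ H p`. -/
def Oracle.lam {d : ℕ} {Ω : Type*} (O : Oracle d Ω) (k : ℕ) (ω : Ω) : ℝ :=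
  inner ℝ (O.p k ω) (O.H k ω (O.p k ω))

section Algorithm

variable {d : ℕ} {Ω : Type*}

/-- Iteration `k` (if it is reached) is a negative curvature step. -/
def NegCurvStep (εg εH : ℝ) (O : Oracle d Ω) (k : ℕ) (ω : Ω) : Prop :=
  ‖O.g k ω‖ ≤ εg ∧ O.lam k ω < -εH

/-- Iteration `k` (if it is reached) returns the current point. -/
def Returns (εg εH : ℝ) (O : Oracle d Ω) (k : ℕ) (ω : Ω) : Prop :=
  ‖O.g k ω‖ ≤ εg ∧ -εH ≤ O.lam k ω

/-- The algorithm has not returned before iteration `k`. -/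
def Reached (εg εH : ℝ) (O : Oracle d Ω) (k : ℕ) (ω : Ω) : Prop :=
  ∀ j < k, ¬ Returns εg εH O j ω

open Classical in
/-- The iterates: a gradient step if `‖g k‖ > εg`, otherwise a negative curvature step with
stepsize `a k` and random sign `σ k` if `lam k < -εH`, and otherwise the algorithm stops. -/
def iterate (L M εg εH : ℝ) (x₀ : E d) (O : Oracle d Ω) (a σ : ℕ → Ω → ℝ) : ℕ → Ω → E d
  | 0, _ => x₀
  | k + 1, ω =>
    if εg < ‖O.g k ω‖ then
      iterate L M εg εH x₀ O a σ k ω - (1 / L) • O.g k ω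
    else if O.lam k ω < -εH then
      iterate L M εg εH x₀ O a σ k ω + (2 * a k ω / M * σ k ω) • O.p k ω
    else
      iterate L M εg εH x₀ O a σ k ω

/-- The algorithm returns at one of the iterations `0, 1, 2, …` with index less than `n`. -/
def TerminatesWithin (εg εH : ℝ) (O : Oracle d Ω) (n : ℝ) (ω : Ω) : Prop :=
  ∃ k : ℕ, (k : ℝ) < n ∧ Reached εg εH O k ω ∧ Returns εg εH O k ω

/-- The signs: `σ k` is `1` or `-1` with probability `1/2` each, independently of everything
(`ℱ k`) that is known at iteration `k` before it is drawn. -/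
structure RandomSigns [mΩ : MeasurableSpace Ω] (μ : Measure Ω) (ℱ : Filtration ℕ mΩ)
    (σ : ℕ → Ω → ℝ) : Prop where
  measurable : ∀ k, Measurable[ℱ (k + 1)] (σ k)
  prob_one : ∀ k, μ {ω | σ k ω = 1} = 1 / 2
  prob_neg_one : ∀ k, μ {ω | σ k ω = -1} = 1 / 2
  indep : ∀ k, Indep (MeasurableSpace.comap (σ k) inferInstance) (ℱ k) μ

/-- What is received at iteration `k` is known before the sign `σ k` is drawn. -/
structure Oracle.Nonanticipating [mΩ : MeasurableSpace Ω] (O : Oracle d Ω)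
    (ℱ : Filtration ℕ mΩ) : Prop where
  g : ∀ k, StronglyMeasurable[ℱ k] (O.g k)
  H : ∀ k, StronglyMeasurable[ℱ k] (O.H k)
  p : ∀ k, StronglyMeasurable[ℱ k] (O.p k)

/-- The inexactness assumptions along a run with iterates `x`, at the iterations that the
algorithm reaches; those on the Hessian and its eigenvector where a Hessian is requested. -/
def InexactnessAssumption (f : E d → ℝ) (D : Set (E d)) (εg εH : ℝ) (O : Oracle d Ω)
    (x : ℕ → Ω → E d) (ω : Ω) : Prop :=
  ∀ k, Reached εg εH O k ω →
    x k ω ∈ D ∧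
    ‖O.g k ω - gradient f (x k ω)‖ ≤ 1 / 3 * max εg ‖O.g k ω‖ ∧
    (‖O.g k ω‖ ≤ εg →
      IsSelfAdjoint (O.H k ω) ∧
      ‖O.H k ω - hessian f (x k ω)‖ ≤ 2 / 9 * εH ∧
      ‖O.p k ω‖ = 1 ∧
      |O.lam k ω - minEigenvalue (O.H k ω)| ≤ 1 / 9 * εH)

end Algorithm

/-- `C_ε = min (εg² / (6L)) (2 εH³ / (9M²))`. -/
def decrease (L M εg εH : ℝ) : ℝ := min (εg ^ 2 / (6 * L)) (2 * εH ^ 3 / (9 * M ^ 2))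

def constB (L M α εg : ℝ) : ℝ := 1 + 18 * α * L / (M * εg)

def constC (M α εg εH : ℝ) : ℝ := 2304 * (M ^ 2 * α ^ 2 * εg ^ 2 / εH ^ 6)

/-- `K`, with `Δ = f x₀ - fbar`. -/
def constK (L M α εg εH Δ δ : ℝ) (η : ℕ) : ℝ :=
  max (constC M α εg εH * Real.log (1 / δ))
    (max (4 * η * constC M α εg εH * (Δ / decrease L M εg εH) ^ (1 / (η : ℝ)))
      (4 * (η : ℝ) ^ 2 * constC M α εg εH ^ (1 + 1 / ((η : ℝ) - 1)) *
        constB L M α εg ^ (1 / ((η : ℝ) - 1))))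

/-- The iteration bound `n = 2 Δ / C_ε + B K`. -/
def constN (L M α εg εH Δ δ : ℝ) (η : ℕ) : ℝ :=
  2 * (Δ / decrease L M εg εH) + constB L M α εg * constK L M α εg εH Δ δ η

/-! The same quantities for `εg = ε`, `εH = √(εM)`, `α = 2L`. -/

def longB (L M ε : ℝ) : ℝ := constB L M (2 * L) ε

def longC (L M ε : ℝ) : ℝ := constC M (2 * L) ε (Real.sqrt (ε * M))

def longK (L M Δ δ : ℝ) (η : ℕ) (ε : ℝ) : ℝ :=
  constK L M (2 * L) ε (Real.sqrt (ε * M)) Δ δ η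

def longN (L M Δ δ : ℝ) (η : ℕ) (ε : ℝ) : ℝ :=
  constN L M (2 * L) ε (Real.sqrt (ε * M)) Δ δ η

/-- `f = Õ(g)`: `f = O(g log^k g)` for some constant `k`. -/
def IsBigOTilde (l : Filter ℝ) (f g : ℝ → ℝ) : Prop :=
  ∃ k : ℕ, f =O[l] fun t => g t * Real.log (g t) ^ k

end InexactNC

end

/-!
While the algorithm runs, each iteration changes `f` by at most `-C_ε` plus a term `σ_k Y_k`. For a
gradient step this is the quadratic upper bound, with `Y_k = 0`. For a negative curvature step of
length `2 α_k / M` it is the cubic upper bound: the second-order term is at most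
`-14 α_k³ / (9 M²)` and outweighs the remainder `4 α_k³ / (3 M²)`, while the first-order term has
the random sign `σ_k` and a coefficient `Y_k` that is known before the draw and bounded by
`8 α ε_g / (3 M)`, because `‖∇f‖ ≤ 4 ε_g / 3` there.

Since `f` is bounded below by `fbar`, not having stopped after `N ≥ 2 Δ / C_ε` iterations forces
`∑ σ_k Y_k ≥ N C_ε / 2`, and the Azuma–Hoeffding inequality makes this an event of probability at
most `δ` as soon as `N ≥ 8 (8 α ε_g / (3 M C_ε))² log (1 / δ)`. For the parameters of the theorem
this bound is at most `B C log (1 / δ) ≤ B K`.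

For the asymptotics, `C_ε = ε² / max (6 L) (9/2 √(M ε))`, `ε B` and `ε C` extend continuously to
`ε = 0`, and hence so do `K` and `n` multiplied by the appropriate powers of `ε`. The rescaled
functions are moreover monotone in `ε`, so that their values at `ε = 1` bound them on `(0, 1]`,
and their values at `ε = 0` are the limit constants.
-/

namespace InexactNC

section Taylor

variable {F G : Type*} [NormedAddCommGroup F] [NormedSpace ℝ F] [NormedAddCommGroup G]
  [NormedSpace ℝ G]

theorem norm_image_sub_le_of_norm_deriv_le_pow {g g' : ℝ → F} {C : ℝ} (k : ℕ)
    (hg : ∀ t ∈ Set.Icc (0 : ℝ) 1, HasDerivAt g (g' t) t)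
    (hg' : ∀ t ∈ Set.Icc (0 : ℝ) 1, ‖g' t‖ ≤ C * t ^ k) :
    ‖g 1 - g 0‖ ≤ C / (k + 1) := by
  have hB : ∀ t, HasDerivAt (fun t : ℝ => C / (k + 1) * t ^ (k + 1)) (C * t ^ k) t := fun t => by
    refine ((hasDerivAt_pow (k + 1) t).const_mul (C / (k + 1))).congr_deriv ?_
    rw [Nat.add_sub_cancel]
    push_cast
    field_simp
  have hg₀ : ∀ t ∈ Set.Icc (0 : ℝ) 1, HasDerivAt (fun t => g t - g 0) (g' t) t := fun t ht =>
    (hg t ht).sub_const (g 0)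
  have h := image_norm_le_of_norm_deriv_right_le_deriv_boundary
    (fun t ht => (hg₀ t ht).continuousAt.continuousWithinAt)
    (fun t ht => (hg₀ t (Set.Ico_subset_Icc_self ht)).hasDerivWithinAt) (by simp) hB
    (fun t ht => hg' t (Set.Ico_subset_Icc_self ht)) (Set.right_mem_Icc.2 zero_le_one)
  simpa using h

theorem hasDerivAt_comp_add_smul {f : F → G} {f' : F →L[ℝ] G} {x s : F} {t : ℝ}
    (hf : HasFDerivAt f f' (x + t • s)) : HasDerivAt (fun t : ℝ => f (x + t • s)) (f' s) t := by
  have hline : HasDerivAt (fun t : ℝ => x + t • s) s t := by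
    simpa using ((hasDerivAt_id t).smul_const s).const_add x
  exact hf.comp_hasDerivAt t hline

theorem norm_taylor_one_remainder_le {f : F → G} {f' : F → F →L[ℝ] G} {D : Set F}
    {L : ℝ} {x s : F} (hD : StarConvex ℝ x D) (hf : ∀ z ∈ D, HasFDerivAt f (f' z) z)
    (hL : ∀ z ∈ D, ‖f' z - f' x‖ ≤ L * ‖z - x‖) (hs : x + s ∈ D) :
    ‖f (x + s) - f x - f' x s‖ ≤ L / 2 * ‖s‖ ^ 2 := by
  have hmem : ∀ t ∈ Set.Icc (0 : ℝ) 1, x + t • s ∈ D := fun t ht =>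
    hD.add_smul_mem hs ht.1 ht.2
  have hderiv : ∀ t ∈ Set.Icc (0 : ℝ) 1,
      HasDerivAt (fun t : ℝ => f (x + t • s) - t • f' x s) ((f' (x + t • s) - f' x) s) t :=
    fun t ht => by
      simpa using (hasDerivAt_comp_add_smul (hf _ (hmem t ht))).fun_sub
        ((hasDerivAt_id t).smul_const (f' x s))
  have hbound : ∀ t ∈ Set.Icc (0 : ℝ) 1,
      ‖(f' (x + t • s) - f' x) s‖ ≤ L * ‖s‖ ^ 2 * t ^ 1 := fun t ht =>
    calc ‖(f' (x + t • s) - f' x) s‖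
        ≤ L * ‖x + t • s - x‖ * ‖s‖ := (f' (x + t • s) - f' x).le_of_opNorm_le
          (hL _ (hmem t ht)) s
      _ = L * ‖s‖ ^ 2 * t ^ 1 := by
        rw [add_sub_cancel_left, norm_smul, Real.norm_of_nonneg ht.1]
        ring
  have h := norm_image_sub_le_of_norm_deriv_le_pow 1 hderiv hbound
  simp only [one_smul, zero_smul, add_zero, sub_zero, Nat.cast_one] at h
  calc ‖f (x + s) - f x - f' x s‖ = ‖f (x + s) - f' x s - f x‖ := by rw [sub_right_comm]
    _ ≤ L / 2 * ‖s‖ ^ 2 := by linarith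

theorem norm_taylor_two_remainder_le {f : F → G} {f' : F → F →L[ℝ] G}
    {f'' : F → F →L[ℝ] F →L[ℝ] G} {D : Set F} {M : ℝ} {x s : F} (hD : StarConvex ℝ x D)
    (hf : ∀ z ∈ D, HasFDerivAt f (f' z) z) (hf' : ∀ z ∈ D, HasFDerivAt f' (f'' z) z)
    (hM : ∀ z ∈ D, ‖f'' z - f'' x‖ ≤ M * ‖z - x‖) (hs : x + s ∈ D) :
    ‖f (x + s) - f x - f' x s - (1 / 2 : ℝ) • f'' x s s‖ ≤ M / 6 * ‖s‖ ^ 3 := by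
  have hmem : ∀ t ∈ Set.Icc (0 : ℝ) 1, x + t • s ∈ D := fun t ht =>
    hD.add_smul_mem hs ht.1 ht.2
  have hderiv : ∀ t ∈ Set.Icc (0 : ℝ) 1,
      HasDerivAt (fun t : ℝ => f (x + t • s) - t • f' x s - (t ^ 2 / 2) • f'' x s s)
        ((f' (x + t • s) - f' x - f'' x (t • s)) s) t := fun t ht => by
    have hquad : HasDerivAt (fun t : ℝ => t ^ 2 / 2) t t := by
      simpa using (hasDerivAt_pow 2 t).div_const 2
    simpa using ((hasDerivAt_comp_add_smul (hf _ (hmem t ht))).fun_sub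
      ((hasDerivAt_id t).smul_const (f' x s))).fun_sub (hquad.smul_const (f'' x s s))
  have hbound : ∀ t ∈ Set.Icc (0 : ℝ) 1,
      ‖(f' (x + t • s) - f' x - f'' x (t • s)) s‖ ≤ M / 2 * ‖s‖ ^ 3 * t ^ 2 := fun t ht =>
    calc ‖(f' (x + t • s) - f' x - f'' x (t • s)) s‖
        ≤ M / 2 * ‖t • s‖ ^ 2 * ‖s‖ := (f' (x + t • s) - f' x - f'' x (t • s)).le_of_opNorm_le
          (norm_taylor_one_remainder_le hD hf' hM (hmem t ht)) s
      _ = M / 2 * ‖s‖ ^ 3 * t ^ 2 := by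
        rw [norm_smul, Real.norm_of_nonneg ht.1]
        ring
  have h := norm_image_sub_le_of_norm_deriv_le_pow 2 hderiv hbound
  simp only [one_smul, zero_smul, add_zero, sub_zero, Nat.cast_ofNat, one_pow,
    zero_pow two_ne_zero, zero_div] at h
  calc ‖f (x + s) - f x - f' x s - (1 / 2 : ℝ) • f'' x s s‖
      = ‖f (x + s) - f' x s - (1 / 2 : ℝ) • f'' x s s - f x‖ := by congr 1; abel
    _ ≤ M / 6 * ‖s‖ ^ 3 := by linarith

end Taylor

section OneStep

variable {V : Type*} [NormedAddCommGroup V] [InnerProductSpace ℝ V]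

theorem sub_mul_norm_sq_le_inner_of_norm_sub_le {g v : V} {θ : ℝ} (h : ‖g - v‖ ≤ θ * ‖g‖) :
    (1 - θ) * ‖g‖ ^ 2 ≤ inner ℝ v g := by
  have hinner : inner ℝ (g - v) g ≤ θ * ‖g‖ * ‖g‖ :=
    (real_inner_le_norm _ _).trans (by gcongr)
  rw [inner_sub_left, real_inner_self_eq_norm_sq] at hinner
  linarith

theorem abs_inner_apply_sub_inner_apply_le (A B : V →L[ℝ] V) {p : V} (hp : ‖p‖ = 1) :
    |inner ℝ p (A p) - inner ℝ p (B p)| ≤ ‖A - B‖ := by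
  simpa [inner_sub_right, hp] using (abs_real_inner_le_norm p ((A - B) p)).trans
    (mul_le_mul_of_nonneg_left ((A - B).le_opNorm p) (norm_nonneg p))

variable {d : ℕ} {f : E d → ℝ} {D : Set (E d)} {L M fbar : ℝ} {x p g s : E d}

theorem BasicAssumption.hasFDerivAt (h : BasicAssumption f D L M fbar) (hx : x ∈ D) :
    HasFDerivAt f (innerSL ℝ (gradient f x)) x :=
  (h.differentiableAt x hx).hasGradientAt.hasFDerivAt

theorem BasicAssumption.hasFDerivAt_innerSL_gradient (h : BasicAssumption f D L M fbar)
    (hx : x ∈ D) :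
    HasFDerivAt (fun z => innerSL ℝ (gradient f z)) ((innerSL ℝ).comp (hessian f x)) x :=
  (innerSL ℝ).hasFDerivAt.comp x (h.differentiableAt_gradient x hx).hasFDerivAt

theorem BasicAssumption.norm_hessian_le (h : BasicAssumption f D L M fbar) (hL : 0 ≤ L)
    (hx : x ∈ D) : ‖hessian f x‖ ≤ L := by
  refine (h.differentiableAt_gradient x hx).hasFDerivAt.le_of_lip' hL ?_
  filter_upwards [h.isOpen.mem_nhds hx] with y hy
  exact h.gradient_lipschitz y hy x hx

theorem BasicAssumption.le_quadratic (h : BasicAssumption f D L M fbar) (hx : x ∈ D)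
    (hs : x + s ∈ D) :
    f (x + s) ≤ f x + inner ℝ (gradient f x) s + L / 2 * ‖s‖ ^ 2 := by
  have htaylor := norm_taylor_one_remainder_le (h.convex hx) (fun z hz => h.hasFDerivAt hz)
    (fun z hz => by
      rw [← map_sub, innerSL_apply_norm]
      exact h.gradient_lipschitz z hz x hx) hs
  rw [innerSL_apply_apply] at htaylor
  linarith [Real.le_norm_self (f (x + s) - f x - inner ℝ (gradient f x) s)]

theorem BasicAssumption.le_cubic (h : BasicAssumption f D L M fbar) (hx : x ∈ D)
    (hs : x + s ∈ D) :
    f (x + s) ≤ f x + inner ℝ (gradient f x) s + 1 / 2 * inner ℝ s (hessian f x s) +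
      M / 6 * ‖s‖ ^ 3 := by
  have htaylor := norm_taylor_two_remainder_le (h.convex hx) (fun z hz => h.hasFDerivAt hz)
    (fun z hz => h.hasFDerivAt_innerSL_gradient hz)
    (fun z hz => by
      refine le_trans ?_ (h.hessian_lipschitz z hz x hx)
      rw [← ContinuousLinearMap.comp_sub]
      exact (ContinuousLinearMap.opNorm_comp_le _ _).trans
        (mul_le_of_le_one_left (norm_nonneg _) (norm_innerSL_le ℝ))) hs
  simp only [ContinuousLinearMap.comp_apply, innerSL_apply_apply, smul_eq_mul,
    real_inner_comm s (hessian f x s)] at htaylor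
  linarith [Real.le_norm_self (f (x + s) - f x - inner ℝ (gradient f x) s -
    1 / 2 * inner ℝ s (hessian f x s))]

theorem BasicAssumption.gradient_step_le (h : BasicAssumption f D L M fbar) (hL : 0 < L) {εg : ℝ}
    (hεg : 0 ≤ εg) (hx : x ∈ D) (hy : x - (1 / L) • g ∈ D) (hg : εg < ‖g‖)
    (hgf : ‖g - gradient f x‖ ≤ 1 / 3 * max εg ‖g‖) :
    f (x - (1 / L) • g) ≤ f x - εg ^ 2 / (6 * L) := by
  rw [max_eq_right hg.le] at hgf
  have hinner := sub_mul_norm_sq_le_inner_of_norm_sub_le hgf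
  rw [sub_eq_add_neg, ← smul_neg] at hy ⊢
  calc f (x + (1 / L) • -g)
      ≤ f x + inner ℝ (gradient f x) ((1 / L) • -g) + L / 2 * ‖(1 / L) • -g‖ ^ 2 :=
        h.le_quadratic hx hy
    _ = f x - 1 / L * (inner ℝ (gradient f x) g - ‖g‖ ^ 2 / 2) := by
        rw [inner_smul_right, inner_neg_right, norm_smul, norm_neg,
          Real.norm_of_nonneg (by positivity)]
        field_simp
        ring
    _ ≤ f x - 1 / L * (εg ^ 2 / 6) := by
        have : εg ^ 2 ≤ ‖g‖ ^ 2 := by gcongr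
        gcongr
        linarith
    _ = f x - εg ^ 2 / (6 * L) := by
        field_simp

theorem BasicAssumption.negCurv_step_le (h : BasicAssumption f D L M fbar) (hM : 0 < M)
    {a σ : ℝ} (ha : 0 ≤ a) (hσ : |σ| = 1) (hx : x ∈ D) (hp : ‖p‖ = 1)
    (hcurv : inner ℝ p (hessian f x p) ≤ -(7 / 9 * a)) (hy : x + (2 * a / M * σ) • p ∈ D) :
    f (x + (2 * a / M * σ) • p) ≤
      f x - 2 * a ^ 3 / (9 * M ^ 2) + σ * (2 * a / M * inner ℝ (gradient f x) p) := by
  have hσ_sq : σ ^ 2 = 1 := by rw [← sq_abs, hσ, one_pow]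
  have hnorm : ‖(2 * a / M * σ) • p‖ = 2 * a / M := by
    rw [norm_smul, hp, Real.norm_eq_abs, abs_mul, hσ, abs_of_nonneg (by positivity), mul_one,
      mul_one]
  calc f (x + (2 * a / M * σ) • p)
      ≤ f x + inner ℝ (gradient f x) ((2 * a / M * σ) • p) +
          1 / 2 * inner ℝ ((2 * a / M * σ) • p) (hessian f x ((2 * a / M * σ) • p)) +
          M / 6 * ‖(2 * a / M * σ) • p‖ ^ 3 := h.le_cubic hx hy
    _ = f x + σ * (2 * a / M * inner ℝ (gradient f x) p) +
          σ ^ 2 * (2 * a ^ 2 / M ^ 2 * inner ℝ p (hessian f x p)) + 4 * a ^ 3 / (3 * M ^ 2) := by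
        rw [hnorm, map_smul, inner_smul_right, inner_smul_right, real_inner_smul_left]
        field_simp
        ring
    _ ≤ f x + σ * (2 * a / M * inner ℝ (gradient f x) p) +
          2 * a ^ 2 / M ^ 2 * -(7 / 9 * a) + 4 * a ^ 3 / (3 * M ^ 2) := by
        rw [hσ_sq, one_mul]
        gcongr
    _ = f x - 2 * a ^ 3 / (9 * M ^ 2) + σ * (2 * a / M * inner ℝ (gradient f x) p) := by
        field_simp
        ring

end OneStep

section MartingaleTransform

theorem exp_mul_le_of_abs_le {u y b : ℝ} (hy : |y| ≤ b) :
    Real.exp (u * y) ≤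
      (1 + y / b) / 2 * Real.exp (u * b) + (1 - y / b) / 2 * Real.exp (-(u * b)) := by
  obtain rfl | hb := (abs_nonneg y).trans hy |>.eq_or_lt
  · norm_num [abs_nonpos_iff.1 hy]
  · have hle : |y / b| ≤ 1 := by rwa [abs_div, abs_of_pos hb, div_le_one hb]
    have hleft : 0 ≤ (1 + y / b) / 2 := by linarith [(abs_le.1 hle).1]
    have hright : 0 ≤ (1 - y / b) / 2 := by linarith [(abs_le.1 hle).2]
    have hconvex := convexOn_exp.2 (Set.mem_univ (u * b)) (Set.mem_univ (-(u * b))) hleft hright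
      (by ring)
    simp only [smul_eq_mul] at hconvex
    have heq : (1 + y / b) / 2 * (u * b) + (1 - y / b) / 2 * -(u * b) = u * y := by
      field_simp
      ring
    rwa [heq] at hconvex

open scoped NNReal

variable {Ω : Type*} {m mΩ : MeasurableSpace Ω} {μ : Measure Ω} {X Y S : Ω → ℝ}
  {cX cS b : ℝ≥0}

theorem integral_mul_exp_le_of_indep {W : Ω → ℝ} (hX : HasSubgaussianMGF X cX μ)
    (hXm : Indep (MeasurableSpace.comap X inferInstance) m μ) (hW : StronglyMeasurable[m] W)
    (hWi : Integrable W μ) (hW₀ : 0 ≤ᵐ[μ] W) (t : ℝ) :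
    Integrable (fun ω => W ω * Real.exp (t * X ω)) μ ∧
      ∫ ω, W ω * Real.exp (t * X ω) ∂μ ≤ Real.exp (cX * t ^ 2 / 2) * ∫ ω, W ω ∂μ := by
  have hindep : IndepFun W (fun ω => Real.exp (t * X ω)) μ :=
    (((IndepFun_iff_Indep X W μ).2 (indep_of_indep_of_le_right hXm hW.measurable.comap_le)).comp
      (φ := fun x => Real.exp (t * x)) (by fun_prop) measurable_id).symm
  refine ⟨hindep.integrable_mul hWi (hX.integrable_exp_mul t), ?_⟩
  rw [hindep.integral_fun_mul_eq_mul_integral hWi.aestronglyMeasurable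
    (hX.integrable_exp_mul t).aestronglyMeasurable, mul_comm]
  exact mul_le_mul_of_nonneg_right (hX.mgf_le t) (integral_nonneg_of_ae hW₀)

theorem integral_le_of_le_mul_exp_add_mul_exp_of_indep {W₁ W₂ Z : Ω → ℝ} {u : ℝ}
    (hX : HasSubgaussianMGF X cX μ) (hXm : Indep (MeasurableSpace.comap X inferInstance) m μ)
    (hW₁ : StronglyMeasurable[m] W₁) (hW₂ : StronglyMeasurable[m] W₂)
    (hW₁i : Integrable W₁ μ) (hW₂i : Integrable W₂ μ) (hW₁₀ : 0 ≤ᵐ[μ] W₁) (hW₂₀ : 0 ≤ᵐ[μ] W₂)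
    (hZ : AEStronglyMeasurable Z μ) (hZ₀ : 0 ≤ᵐ[μ] Z)
    (hle : ∀ᵐ ω ∂μ, Z ω ≤ W₁ ω * Real.exp (u * X ω) + W₂ ω * Real.exp (-u * X ω)) :
    Integrable Z μ ∧ ∫ ω, Z ω ∂μ ≤ Real.exp (cX * u ^ 2 / 2) * ∫ ω, W₁ ω + W₂ ω ∂μ := by
  obtain ⟨hint₁, hle₁⟩ := integral_mul_exp_le_of_indep hX hXm hW₁ hW₁i hW₁₀ u
  obtain ⟨hint₂, hle₂⟩ := integral_mul_exp_le_of_indep hX hXm hW₂ hW₂i hW₂₀ (-u)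
  have hint : Integrable Z μ := (hint₁.add hint₂).mono' hZ (by
    filter_upwards [hle, hZ₀] with ω hω hω₀
    exact (Real.norm_of_nonneg hω₀).trans_le hω)
  refine ⟨hint, (integral_mono_ae hint (hint₁.add hint₂) hle).trans ?_⟩
  rw [neg_sq] at hle₂
  rw [integral_add hW₁i hW₂i, mul_add]
  exact (integral_add hint₁ hint₂).trans_le (add_le_add hle₁ hle₂)

/- Given the past, `exp (t * X * Y)` lies below the chord of `exp` between `± t * b * X`, whose
coefficients depend only on the past; this reduces a bounded `Y` to the constants `± b`. -/
theorem mgf_add_mul_le_of_indep (hm : m ≤ mΩ) (hX : HasSubgaussianMGF X cX μ)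
    (hXm : Indep (MeasurableSpace.comap X inferInstance) m μ) (hS : StronglyMeasurable[m] S)
    (hY : StronglyMeasurable[m] Y) (hYb : ∀ᵐ ω ∂μ, |Y ω| ≤ b) {t : ℝ}
    (ht : Integrable (fun ω => Real.exp (t * S ω)) μ) :
    Integrable (fun ω => Real.exp (t * (S ω + X ω * Y ω))) μ ∧
      mgf (fun ω => S ω + X ω * Y ω) μ t ≤ Real.exp (cX * (t * b) ^ 2 / 2) * mgf S μ t := by
  let W (r : ℝ) (ω : Ω) : ℝ := Real.exp (t * S ω) * ((1 + r * (Y ω / b)) / 2)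
  have hWm : ∀ r, StronglyMeasurable[m] (W r) := fun r =>
    ((hS.measurable.const_mul t).exp.mul
      ((((hY.measurable.div_const _).const_mul r).const_add 1).div_const 2)).stronglyMeasurable
  have hW : ∀ r, |r| = 1 → ∀ᵐ ω ∂μ, 0 ≤ W r ω ∧ W r ω ≤ Real.exp (t * S ω) := by
    intro r hr
    filter_upwards [hYb] with ω hω
    have hratio : |r * (Y ω / b)| ≤ 1 := by
      rw [abs_mul, hr, one_mul, abs_div, NNReal.abs_eq]
      exact div_le_one_of_le₀ hω b.2
    obtain ⟨hlower, hupper⟩ := abs_le.1 hratio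
    exact ⟨mul_nonneg (Real.exp_pos _).le (by linarith),
      mul_le_of_le_one_right (Real.exp_pos _).le (by linarith)⟩
  have hWi : ∀ r, |r| = 1 → Integrable (W r) μ := fun r hr =>
    ht.mono' ((hWm r).mono hm).aestronglyMeasurable
      ((hW r hr).mono fun ω hω => (Real.norm_of_nonneg hω.1).trans_le hω.2)
  have hW_add : ∀ ω, W 1 ω + W (-1) ω = Real.exp (t * S ω) := fun ω => by
    simp only [W]
    ring
  have hmeas : AEMeasurable (fun ω => t * (S ω + X ω * Y ω)) μ :=
    ((hS.mono hm).measurable.aemeasurable.add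
      (hX.aemeasurable.mul (hY.mono hm).measurable.aemeasurable)).const_mul t
  have hle : ∀ᵐ ω ∂μ, Real.exp (t * (S ω + X ω * Y ω)) ≤
      W 1 ω * Real.exp (t * b * X ω) + W (-1) ω * Real.exp (-(t * b) * X ω) := by
    filter_upwards [hYb] with ω hω
    calc Real.exp (t * (S ω + X ω * Y ω)) = Real.exp (t * S ω) * Real.exp (t * X ω * Y ω) := by
          rw [← Real.exp_add]
          ring_nf
      _ ≤ _ := mul_le_mul_of_nonneg_left (exp_mul_le_of_abs_le hω) (Real.exp_pos _).le
      _ = _ := by simp only [W]; ring_nf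
  have h := integral_le_of_le_mul_exp_add_mul_exp_of_indep hX hXm (hWm 1) (hWm (-1))
    (hWi 1 abs_one) (hWi (-1) (by simp)) ((hW 1 abs_one).mono fun _ h => h.1)
    ((hW (-1) (by simp)).mono fun _ h => h.1) hmeas.exp.aestronglyMeasurable
    (ae_of_all _ fun _ => (Real.exp_pos _).le) hle
  simp only [hW_add] at h
  exact h

theorem hasSubgaussianMGF_add_mul_of_indep (hm : m ≤ mΩ) (hS : HasSubgaussianMGF S cS μ)
    (hSm : StronglyMeasurable[m] S) (hX : HasSubgaussianMGF X cX μ)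
    (hXm : Indep (MeasurableSpace.comap X inferInstance) m μ) (hY : StronglyMeasurable[m] Y)
    (hYb : ∀ᵐ ω ∂μ, |Y ω| ≤ b) :
    HasSubgaussianMGF (fun ω => S ω + X ω * Y ω) (cS + b ^ 2 * cX) μ := by
  have h : ∀ t, _ := fun t =>
    mgf_add_mul_le_of_indep hm hX hXm hSm hY hYb (hS.integrable_exp_mul t)
  refine ⟨fun t => (h t).1, fun t => (h t).2.trans ?_⟩
  grw [hS.mgf_le t, ← Real.exp_add]
  refine Real.exp_le_exp.2 (le_of_eq ?_)
  push_cast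
  ring

variable {ℱ : Filtration ℕ mΩ}

/- Independence of the past takes the place of conditional sub-Gaussianity, so that, unlike in
`measure_sum_ge_le_of_hasCondSubgaussianMGF`, the space `Ω` need not be standard Borel. -/
theorem hasSubgaussianMGF_sum_mul_of_indep {X Y : ℕ → Ω → ℝ} {c b : ℕ → ℝ≥0}
    [IsProbabilityMeasure μ] (hX : ∀ k, HasSubgaussianMGF (X k) (c k) μ)
    (hXm : ∀ k, Measurable[ℱ (k + 1)] (X k))
    (hindep : ∀ k, Indep (MeasurableSpace.comap (X k) inferInstance) (ℱ k) μ)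
    (hY : ∀ k, StronglyMeasurable[ℱ k] (Y k)) (hYb : ∀ k, ∀ᵐ ω ∂μ, |Y k ω| ≤ b k) (N : ℕ) :
    HasSubgaussianMGF (fun ω => ∑ k ∈ Finset.range N, X k ω * Y k ω)
      (∑ k ∈ Finset.range N, b k ^ 2 * c k) μ := by
  induction N with
  | zero => simp
  | succ N ih =>
    have hmeas : StronglyMeasurable[ℱ N] fun ω => ∑ k ∈ Finset.range N, X k ω * Y k ω :=
      Finset.stronglyMeasurable_fun_sum _ fun k hk =>
        ((hXm k).stronglyMeasurable.mono (ℱ.mono (Finset.mem_range.1 hk))).mul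
          ((hY k).mono (ℱ.mono (Finset.mem_range.1 hk).le))
    simpa only [Finset.sum_range_succ] using hasSubgaussianMGF_add_mul_of_indep (ℱ.le N) ih hmeas
      (hX N) (hindep N) (hY N) (hYb N)

end MartingaleTransform

section RandomSigns

variable {Ω : Type*} [mΩ : MeasurableSpace Ω] {μ : Measure Ω} [IsProbabilityMeasure μ]
  {ℱ : Filtration ℕ mΩ} {σ : ℕ → Ω → ℝ}

theorem RandomSigns.ae_abs_eq_one (h : RandomSigns μ ℱ σ) : ∀ᵐ ω ∂μ, ∀ k, |σ k ω| = 1 := by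
  refine ae_all_iff.2 fun k => ?_
  have hσ : Measurable (σ k) := (h.measurable k).mono (ℱ.le _) le_rfl
  have hdisj : Disjoint {ω | σ k ω = 1} {ω | σ k ω = -1} :=
    Set.disjoint_left.2 fun ω (h₁ : σ k ω = 1) (h₂ : σ k ω = -1) => by linarith
  have hprob : μ ({ω | σ k ω = 1} ∪ {ω | σ k ω = -1}) = 1 := by
    rw [measure_union hdisj (hσ (measurableSet_singleton _)), h.prob_one, h.prob_neg_one,
      ENNReal.add_halves]
  filter_upwards [(mem_ae_iff_prob_eq_one ((hσ (measurableSet_singleton _)).union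
    (hσ (measurableSet_singleton _)))).2 hprob] with ω hω
  exact (abs_eq zero_le_one).2 hω

theorem RandomSigns.integral_eq_zero (h : RandomSigns μ ℱ σ) (k : ℕ) : ∫ ω, σ k ω ∂μ = 0 := by
  have hσ : Measurable (σ k) := (h.measurable k).mono (ℱ.le _) le_rfl
  have hpos : MeasurableSet {ω | σ k ω = 1} := hσ (measurableSet_singleton 1)
  have hneg : MeasurableSet {ω | σ k ω = -1} := hσ (measurableSet_singleton (-1))
  have heq : σ k =ᵐ[μ] fun ω => Set.indicator {ω | σ k ω = 1} (1 : Ω → ℝ) ω -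
      Set.indicator {ω | σ k ω = -1} (1 : Ω → ℝ) ω := by
    filter_upwards [h.ae_abs_eq_one] with ω hω
    rcases eq_or_eq_neg_of_abs_eq (hω k) with hk | hk <;> norm_num [Set.indicator, hk]
  rw [integral_congr_ae heq, integral_sub ((integrable_const 1).indicator hpos)
    ((integrable_const 1).indicator hneg), integral_indicator_one hpos,
    integral_indicator_one hneg, measureReal_def, measureReal_def, h.prob_one, h.prob_neg_one,
    sub_self]

theorem RandomSigns.hasSubgaussianMGF (h : RandomSigns μ ℱ σ) (k : ℕ) :
    HasSubgaussianMGF (σ k) 1 μ := by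
  have hσ : Measurable (σ k) := (h.measurable k).mono (ℱ.le _) le_rfl
  have hmem : ∀ᵐ ω ∂μ, σ k ω ∈ Set.Icc (-1) 1 := by
    filter_upwards [h.ae_abs_eq_one] with ω hω
    exact abs_le.1 (hω k).le
  have hhoeffding := hasSubgaussianMGF_of_mem_Icc_of_integral_eq_zero hσ.aemeasurable hmem
    (h.integral_eq_zero k)
  convert hhoeffding
  norm_num

theorem RandomSigns.measureReal_sum_ge_le (h : RandomSigns μ ℱ σ) {Y : ℕ → Ω → ℝ} {c : ℝ}
    (hc : 0 ≤ c) (hY : ∀ k, StronglyMeasurable[ℱ k] (Y k)) (hYc : ∀ k, ∀ᵐ ω ∂μ, |Y k ω| ≤ c)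
    (N : ℕ) {t : ℝ} (ht : 0 ≤ t) :
    μ.real {ω | t ≤ ∑ k ∈ Finset.range N, σ k ω * Y k ω} ≤
      Real.exp (-t ^ 2 / (2 * (N * c ^ 2))) := by
  lift c to NNReal using hc
  simpa using (hasSubgaussianMGF_sum_mul_of_indep h.hasSubgaussianMGF h.measurable h.indep hY hYc
    N).measure_ge_le ht

end RandomSigns

section Run

variable {d : ℕ} {Ω : Type*} {O : Oracle d Ω} {a σ : ℕ → Ω → ℝ} {x : ℕ → Ω → E d} {f : E d → ℝ}
  {D : Set (E d)} {L M fbar εg εH α : ℝ} {x₀ : E d} {ω : Ω} {j k N : ℕ}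

/-- The accuracy of the oracle on which termination rests: `H k` is any operator close to the
Hessian and `p k` is any unit vector. -/
def WeakInexactness (f : E d → ℝ) (D : Set (E d)) (εg εH : ℝ) (O : Oracle d Ω)
    (x : ℕ → Ω → E d) (ω : Ω) : Prop :=
  ∀ k, Reached εg εH O k ω →
    x k ω ∈ D ∧
    ‖O.g k ω - gradient f (x k ω)‖ ≤ 1 / 3 * max εg ‖O.g k ω‖ ∧
    (‖O.g k ω‖ ≤ εg → ‖O.H k ω - hessian f (x k ω)‖ ≤ 2 / 9 * εH ∧ ‖O.p k ω‖ = 1)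

/-- The stepsizes of the negative curvature steps that are taken lie in `[εH, min α |lam k|]`. -/
def AdmissibleStepsizes (α εg εH : ℝ) (O : Oracle d Ω) (a : ℕ → Ω → ℝ) (ω : Ω) : Prop :=
  ∀ k, Reached εg εH O k ω → NegCurvStep εg εH O k ω →
    a k ω ∈ Set.Icc εH (min α |O.lam k ω|)

/-- The coefficient of the random sign in the first-order change of `f` at iteration `k`; it
vanishes unless iteration `k` is reached and takes a negative curvature step. -/
noncomputable def noise (f : E d → ℝ) (M εg εH : ℝ) (O : Oracle d Ω) (a : ℕ → Ω → ℝ)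
    (x : ℕ → Ω → E d) (k : ℕ) : Ω → ℝ :=
  Set.indicator {ω | Reached εg εH O k ω ∧ NegCurvStep εg εH O k ω} fun ω =>
    2 * a k ω / M * inner ℝ (gradient f (x k ω)) (O.p k ω)

/-- The almost sure bound on `noise`. -/
noncomputable def noiseBound (M α εg : ℝ) : ℝ := 8 * α * εg / (3 * M)

theorem InexactnessAssumption.weakInexactness (h : InexactnessAssumption f D εg εH O x ω) :
    WeakInexactness f D εg εH O x ω := fun k hk =>
  let ⟨hx, hg, hH⟩ := h k hk
  ⟨hx, hg, fun hgε => ⟨(hH hgε).2.1, (hH hgε).2.2.1⟩⟩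

theorem noise_of_negCurvStep (hk : Reached εg εH O k ω) (hstep : NegCurvStep εg εH O k ω) :
    noise f M εg εH O a x k ω = 2 * a k ω / M * inner ℝ (gradient f (x k ω)) (O.p k ω) :=
  Set.indicator_of_mem (s := {ω | Reached εg εH O k ω ∧ NegCurvStep εg εH O k ω}) ⟨hk, hstep⟩ _

theorem noise_eq_zero (h : ¬(Reached εg εH O k ω ∧ NegCurvStep εg εH O k ω)) :
    noise f M εg εH O a x k ω = 0 :=
  Set.indicator_of_notMem (s := {ω | Reached εg εH O k ω ∧ NegCurvStep εg εH O k ω}) h _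

theorem Reached.mono (h : Reached εg εH O k ω) (hjk : j ≤ k) : Reached εg εH O j ω :=
  fun i hi => h i (hi.trans_le hjk)

theorem Reached.lt_norm_or_negCurvStep (h : Reached εg εH O (k + 1) ω) :
    εg < ‖O.g k ω‖ ∨ NegCurvStep εg εH O k ω := by
  by_contra! hstep
  have hg : ‖O.g k ω‖ ≤ εg := hstep.1
  exact h k k.lt_succ_self ⟨hg, not_lt.1 fun hlam => hstep.2 ⟨hg, hlam⟩⟩

theorem reached_ceil_of_not_terminatesWithin {n : ℝ} (h : ¬ TerminatesWithin εg εH O n ω) :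
    Reached εg εH O ⌈n⌉₊ ω := by
  intro j
  induction j using Nat.strong_induction_on with
  | _ j ih =>
    exact fun hj hreturns => h ⟨j, Nat.lt_ceil.1 hj, fun i hi => ih i hi (hi.trans hj), hreturns⟩

theorem iterate_succ_of_lt_norm (h : εg < ‖O.g k ω‖) :
    iterate L M εg εH x₀ O a σ (k + 1) ω =
      iterate L M εg εH x₀ O a σ k ω - (1 / L) • O.g k ω := by
  rw [iterate, if_pos h]

theorem iterate_succ_of_negCurvStep (h : NegCurvStep εg εH O k ω) :
    iterate L M εg εH x₀ O a σ (k + 1) ω =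
      iterate L M εg εH x₀ O a σ k ω + (2 * a k ω / M * σ k ω) • O.p k ω := by
  rw [iterate, if_neg h.1.not_gt, if_pos h.2]

theorem WeakInexactness.abs_lam_sub_le (h : WeakInexactness f D εg εH O x ω)
    (hk : Reached εg εH O k ω) (hstep : NegCurvStep εg εH O k ω) :
    |O.lam k ω - inner ℝ (O.p k ω) (hessian f (x k ω) (O.p k ω))| ≤ 2 / 9 * εH := by
  obtain ⟨-, -, hH⟩ := h k hk
  obtain ⟨hHess, hp⟩ := hH hstep.1
  exact (abs_inner_apply_sub_inner_apply_le _ _ hp).trans hHess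

theorem WeakInexactness.admissibleStepsizes_abs_lam (hω : WeakInexactness f D εg εH O x ω)
    (h : BasicAssumption f D L M fbar) (hL : 0 ≤ L) (hεH : 0 ≤ εH) :
    AdmissibleStepsizes (2 * L) εg εH O (fun k ω => |O.lam k ω|) ω := by
  intro k hk hstep
  obtain ⟨hx, -, hH⟩ := hω k hk
  have hcurv : |inner ℝ (O.p k ω) (hessian f (x k ω) (O.p k ω))| ≤ L := by
    simpa using (abs_inner_apply_sub_inner_apply_le (hessian f (x k ω)) 0 (hH hstep.1).2).trans
      ((sub_zero (hessian f (x k ω))).symm ▸ h.norm_hessian_le hL hx)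
  have hlam := hstep.2
  have habs : |O.lam k ω| = -O.lam k ω := abs_of_neg (by linarith)
  have hclose := abs_le.1 (hω.abs_lam_sub_le hk hstep)
  refine ⟨by linarith, le_min ?_ le_rfl⟩
  linarith [(abs_le.1 hcurv).1, hclose.1]

theorem WeakInexactness.curvature_le (hω : WeakInexactness f D εg εH O x ω)
    (ha : AdmissibleStepsizes α εg εH O a ω) (hεH : 0 ≤ εH) (hk : Reached εg εH O k ω)
    (hstep : NegCurvStep εg εH O k ω) :
    inner ℝ (O.p k ω) (hessian f (x k ω) (O.p k ω)) ≤ -(7 / 9 * a k ω) := by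
  obtain ⟨hεH_le, hle⟩ := ha k hk hstep
  have hlam := hle.trans (min_le_right _ _)
  rw [abs_of_neg (hstep.2.trans_le (neg_nonpos.2 hεH))] at hlam
  linarith [(abs_le.1 (hω.abs_lam_sub_le hk hstep)).1]

theorem WeakInexactness.abs_inner_gradient_le (hω : WeakInexactness f D εg εH O x ω)
    (hk : Reached εg εH O k ω) (hstep : NegCurvStep εg εH O k ω) :
    |inner ℝ (gradient f (x k ω)) (O.p k ω)| ≤ 4 / 3 * εg := by
  obtain ⟨-, hg, hH⟩ := hω k hk
  rw [max_eq_left hstep.1] at hg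
  have hinner := abs_real_inner_le_norm (gradient f (x k ω)) (O.p k ω)
  rw [(hH hstep.1).2, mul_one] at hinner
  linarith [norm_le_norm_add_norm_sub (O.g k ω) (gradient f (x k ω)), hstep.1]

theorem WeakInexactness.abs_noise_le (hω : WeakInexactness f D εg εH O x ω)
    (ha : AdmissibleStepsizes α εg εH O a ω) (hM : 0 < M) (hα : 0 ≤ α) (hεg : 0 ≤ εg)
    (hεH : 0 ≤ εH) (k : ℕ) : |noise f M εg εH O a x k ω| ≤ noiseBound M α εg := by
  by_cases hk : Reached εg εH O k ω ∧ NegCurvStep εg εH O k ω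
  · obtain ⟨hεH_le, hle⟩ := ha k hk.1 hk.2
    have ha₀ : 0 ≤ a k ω := hεH.trans hεH_le
    rw [noise_of_negCurvStep hk.1 hk.2, abs_mul, abs_of_nonneg (by positivity)]
    calc 2 * a k ω / M * |inner ℝ (gradient f (x k ω)) (O.p k ω)|
        ≤ 2 * α / M * (4 / 3 * εg) := by
          gcongr
          · exact hle.trans (min_le_left _ _)
          · exact hω.abs_inner_gradient_le hk.1 hk.2
      _ = noiseBound M α εg := by
          rw [noiseBound]
          field
  · rw [noise_eq_zero hk, abs_zero, noiseBound]
    positivity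

theorem BasicAssumption.iterate_succ_le (h : BasicAssumption f D L M fbar) (hL : 0 < L)
    (hM : 0 < M) (hεg : 0 ≤ εg) (hεH : 0 ≤ εH) (hx : x = iterate L M εg εH x₀ O a σ)
    (hσ : |σ k ω| = 1) (hω : WeakInexactness f D εg εH O x ω)
    (ha : AdmissibleStepsizes α εg εH O a ω) (hk : Reached εg εH O (k + 1) ω) :
    f (x (k + 1) ω) ≤
      f (x k ω) - decrease L M εg εH + σ k ω * noise f M εg εH O a x k ω := by
  have hk' : Reached εg εH O k ω := hk.mono k.le_succ
  obtain ⟨hmem, hg, hH⟩ := hω k hk'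
  have hmem' : x (k + 1) ω ∈ D := (hω (k + 1) hk).1
  rcases hk.lt_norm_or_negCurvStep with hlarge | hstep
  · have hsucc : x (k + 1) ω = x k ω - (1 / L) • O.g k ω := hx ▸ iterate_succ_of_lt_norm hlarge
    have hnoise : noise f M εg εH O a x k ω = 0 :=
      noise_eq_zero fun hstep => hstep.2.1.not_gt hlarge
    rw [hnoise, mul_zero, add_zero, hsucc]
    rw [hsucc] at hmem'
    have hdecrease : decrease L M εg εH ≤ εg ^ 2 / (6 * L) := min_le_left _ _
    linarith [h.gradient_step_le hL hεg hmem hmem' hlarge hg]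
  · have hsucc : x (k + 1) ω = x k ω + (2 * a k ω / M * σ k ω) • O.p k ω :=
      hx ▸ iterate_succ_of_negCurvStep hstep
    have hεH_le : εH ≤ a k ω := (ha k hk' hstep).1
    rw [hsucc] at hmem'
    rw [noise_of_negCurvStep hk' hstep, hsucc]
    have hdecrease : decrease L M εg εH ≤ 2 * a k ω ^ 3 / (9 * M ^ 2) :=
      (min_le_right _ _).trans (by gcongr)
    linarith [h.negCurv_step_le hM (hεH.trans hεH_le) hσ hmem (hH hstep.1).2
      (hω.curvature_le ha hεH hk' hstep) hmem']

theorem BasicAssumption.iterate_le (h : BasicAssumption f D L M fbar) (hL : 0 < L) (hM : 0 < M)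
    (hεg : 0 ≤ εg) (hεH : 0 ≤ εH) (hx : x = iterate L M εg εH x₀ O a σ)
    (hσ : ∀ k, |σ k ω| = 1) (hω : WeakInexactness f D εg εH O x ω)
    (ha : AdmissibleStepsizes α εg εH O a ω) (hN : Reached εg εH O N ω) :
    f (x N ω) ≤ f x₀ - N * decrease L M εg εH +
      ∑ k ∈ Finset.range N, σ k ω * noise f M εg εH O a x k ω := by
  induction N with
  | zero => simp [hx, iterate]
  | succ N ih =>
    rw [Finset.sum_range_succ, Nat.cast_succ]
    linarith [ih (hN.mono N.le_succ), h.iterate_succ_le hL hM hεg hεH hx (hσ N) hω ha hN]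

end Run

section Measurability

variable {d : ℕ} {Ω : Type*} [mΩ : MeasurableSpace Ω] {ℱ : Filtration ℕ mΩ} {μ : Measure Ω}
  {O : Oracle d Ω} {a σ : ℕ → Ω → ℝ} {x : ℕ → Ω → E d}

theorem measurable_gradient (f : E d → ℝ) : Measurable (gradient f) :=
  (InnerProductSpace.toDual ℝ (E d)).symm.continuous.measurable.comp (measurable_fderiv ℝ f)

theorem Oracle.Nonanticipating.lam (hO : O.Nonanticipating ℱ) (k : ℕ) :
    StronglyMeasurable[ℱ k] (O.lam k) := by
  have hcont : Continuous fun z : (E d →L[ℝ] E d) × E d => (inner ℝ z.2 (z.1 z.2) : ℝ) := by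
    fun_prop
  exact hcont.comp_stronglyMeasurable ((hO.H k).prodMk (hO.p k))

theorem Oracle.Nonanticipating.measurableSet_negCurvStep (hO : O.Nonanticipating ℱ)
    (εg εH : ℝ) (k : ℕ) : MeasurableSet[ℱ k] {ω | NegCurvStep εg εH O k ω} :=
  (measurableSet_le (hO.g k).norm.measurable measurable_const).inter
    (measurableSet_lt (hO.lam k).measurable measurable_const)

theorem Oracle.Nonanticipating.measurableSet_returns (hO : O.Nonanticipating ℱ)
    (εg εH : ℝ) (k : ℕ) : MeasurableSet[ℱ k] {ω | Returns εg εH O k ω} :=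
  (measurableSet_le (hO.g k).norm.measurable measurable_const).inter
    (measurableSet_le measurable_const (hO.lam k).measurable)

theorem Oracle.Nonanticipating.measurableSet_reached (hO : O.Nonanticipating ℱ)
    (εg εH : ℝ) (k : ℕ) : MeasurableSet[ℱ k] {ω | Reached εg εH O k ω} := by
  simp only [Reached, Set.ofPred_forall]
  exact MeasurableSet.iInter fun j => MeasurableSet.iInter fun hj =>
    (ℱ.mono hj.le _ (hO.measurableSet_returns εg εH j)).compl

theorem Oracle.Nonanticipating.iterate (hO : O.Nonanticipating ℱ)
    (hσ : ∀ k, Measurable[ℱ (k + 1)] (σ k)) (ha : ∀ k, StronglyMeasurable[ℱ k] (a k))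
    (L M εg εH : ℝ) (x₀ : E d) (k : ℕ) :
    StronglyMeasurable[ℱ k] (iterate L M εg εH x₀ O a σ k) := by
  induction k with
  | zero => exact stronglyMeasurable_const
  | succ k ih =>
    have hle : ℱ k ≤ ℱ (k + 1) := ℱ.mono k.le_succ
    have hx := ih.mono hle
    have hg := (hO.g k).mono hle
    have hscale : StronglyMeasurable[ℱ (k + 1)] fun ω => 2 * a k ω / M * σ k ω :=
      (((((ha k).mono hle).measurable.const_mul 2).div_const M).mul (hσ k)).stronglyMeasurable
    exact (hx.sub (hg.fun_const_smul (1 / L))).ite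
      (measurableSet_lt measurable_const hg.norm.measurable)
      ((hx.add (hscale.smul ((hO.p k).mono hle))).ite
        (measurableSet_lt ((hO.lam k).mono hle).measurable measurable_const) hx)

theorem Oracle.Nonanticipating.noise (hO : O.Nonanticipating ℱ) (f : E d → ℝ) (M εg εH : ℝ)
    {k : ℕ} (ha : StronglyMeasurable[ℱ k] (a k)) (hx : StronglyMeasurable[ℱ k] (x k)) :
    StronglyMeasurable[ℱ k] (noise f M εg εH O a x k) := by
  have hgradient : StronglyMeasurable[ℱ k] fun ω => gradient f (x k ω) :=
    ((measurable_gradient f).comp hx.measurable).stronglyMeasurable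
  have hscale : StronglyMeasurable[ℱ k] fun ω => 2 * a k ω / M :=
    ((ha.measurable.const_mul 2).div_const M).stronglyMeasurable
  exact (hscale.mul (continuous_inner.comp_stronglyMeasurable
    (hgradient.prodMk (hO.p k)))).indicator
      ((hO.measurableSet_reached εg εH k).inter (hO.measurableSet_negCurvStep εg εH k))

end Measurability

section Termination

theorem exp_neg_sq_le_of_mul_log_le {c m N δ : ℝ} (hc : 0 < c) (hm : 0 < m) (hN : 0 < N)
    (hδ : 0 < δ) (h : 8 * (c / m) ^ 2 * Real.log (1 / δ) ≤ N) :
    Real.exp (-(N * (m / 2)) ^ 2 / (2 * (N * c ^ 2))) ≤ δ := by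
  have hexponent : -(N * (m / 2)) ^ 2 / (2 * (N * c ^ 2)) = -(N / (8 * (c / m) ^ 2)) := by
    field
  rw [← Real.le_log_iff_exp_le hδ, hexponent, neg_le, ← Real.log_inv, ← one_div,
    le_div_iff₀ (by positivity)]
  linarith

theorem decrease_pos {L M εg εH : ℝ} (hL : 0 < L) (hM : 0 < M) (hεg : 0 < εg) (hεH : 0 < εH) :
    0 < decrease L M εg εH :=
  lt_min (by positivity) (by positivity)

variable {d : ℕ} {Ω : Type*} [mΩ : MeasurableSpace Ω] {ℱ : Filtration ℕ mΩ} {μ : Measure Ω}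
  [IsProbabilityMeasure μ] {O : Oracle d Ω} {a σ : ℕ → Ω → ℝ} {f : E d → ℝ} {D : Set (E d)}
  {L M fbar εg εH α n δ : ℝ} {x₀ : E d} {x : ℕ → Ω → E d}

theorem BasicAssumption.measureReal_not_terminatesWithin_le
    (h : BasicAssumption f D L M fbar) (hL : 0 < L) (hM : 0 < M) (hεg : 0 < εg) (hεH : 0 < εH)
    (hx : x = iterate L M εg εH x₀ O a σ) (hσ : ∀ᵐ ω ∂μ, ∀ k, |σ k ω| = 1)
    (hω : ∀ᵐ ω ∂μ, WeakInexactness f D εg εH O x ω)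
    (ha : ∀ᵐ ω ∂μ, AdmissibleStepsizes α εg εH O a ω)
    (hn : 2 * ((f x₀ - fbar) / decrease L M εg εH) ≤ n) :
    μ.real {ω | TerminatesWithin εg εH O n ω}ᶜ ≤
      μ.real {ω | ⌈n⌉₊ * (decrease L M εg εH / 2) ≤
        ∑ k ∈ Finset.range ⌈n⌉₊, σ k ω * noise f M εg εH O a x k ω} := by
  refine ENNReal.toReal_mono (measure_ne_top _ _) (measure_mono_ae ?_)
  filter_upwards [hσ, hω, ha] with ω hσω hωω haω hnot
  have hreached : Reached εg εH O ⌈n⌉₊ ω := reached_ceil_of_not_terminatesWithin hnot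
  have hgap : 2 * (f x₀ - fbar) ≤ ⌈n⌉₊ * decrease L M εg εH := by
    rw [← div_le_iff₀ (decrease_pos hL hM hεg hεH), mul_div_assoc]
    exact hn.trans (Nat.le_ceil n)
  have hbelow : fbar ≤ f (x ⌈n⌉₊ ω) := h.bounded_below _ (hωω _ hreached).1
  have hdescent := h.iterate_le hL hM hεg.le hεH.le hx hσω hωω haω hreached
  change _ ≤ _
  linarith

theorem BasicAssumption.le_measureReal_terminatesWithin
    (h : BasicAssumption f D L M fbar) (hL : 0 < L) (hM : 0 < M) (hεg : 0 < εg) (hεH : 0 < εH)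
    (hα : 0 < α) (hσ : RandomSigns μ ℱ σ) (hO : O.Nonanticipating ℱ)
    (ham : ∀ k, StronglyMeasurable[ℱ k] (a k))
    (hω : ∀ᵐ ω ∂μ, WeakInexactness f D εg εH O (iterate L M εg εH x₀ O a σ) ω)
    (ha : ∀ᵐ ω ∂μ, AdmissibleStepsizes α εg εH O a ω) (hδ₀ : 0 < δ) (hδ₁ : δ < 1)
    (hn : 2 * ((f x₀ - fbar) / decrease L M εg εH) +
      8 * (noiseBound M α εg / decrease L M εg εH) ^ 2 * Real.log (1 / δ) ≤ n) :
    1 - δ ≤ μ.real {ω | TerminatesWithin εg εH O n ω} := by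
  set x := iterate L M εg εH x₀ O a σ with hx
  set c := noiseBound M α εg with hc
  set m := decrease L M εg εH
  have hc₀ : 0 < c := by rw [hc, noiseBound]; positivity
  have hm₀ : 0 < m := decrease_pos hL hM hεg hεH
  have hΔ : 0 ≤ (f x₀ - fbar) / m := by
    obtain ⟨ω, hω⟩ := hω.exists
    have hx₀ : x₀ ∈ D := (hω 0 fun _ hj => absurd hj (Nat.not_lt_zero _)).1
    exact div_nonneg (sub_nonneg.2 (h.bounded_below x₀ hx₀)) hm₀.le
  have hlog : 0 < Real.log (1 / δ) := Real.log_pos (one_lt_one_div hδ₀ hδ₁)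
  have hlog' : 0 < 8 * (c / m) ^ 2 * Real.log (1 / δ) := by positivity
  have hceil : n ≤ ⌈n⌉₊ := Nat.le_ceil n
  have hY : ∀ k, StronglyMeasurable[ℱ k] (noise f M εg εH O a x k) := fun k =>
    hO.noise f M εg εH (ham k) (hO.iterate hσ.measurable ham L M εg εH x₀ k)
  have hYc : ∀ k, ∀ᵐ ω ∂μ, |noise f M εg εH O a x k ω| ≤ c := fun k => by
    filter_upwards [hω, ha] with ω hωω haω
    exact hωω.abs_noise_le haω hM hα.le hεg.le hεH.le k
  have hbad : μ.real {ω | TerminatesWithin εg εH O n ω}ᶜ ≤ δ :=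
    (h.measureReal_not_terminatesWithin_le hL hM hεg hεH hx hσ.ae_abs_eq_one hω ha
      (by linarith)).trans <|
    (hσ.measureReal_sum_ge_le hc₀.le hY hYc ⌈n⌉₊ (by positivity)).trans <|
    exp_neg_sq_le_of_mul_log_le hc₀ hm₀ (by linarith) hδ₀ (by linarith)
  have hunion := measureReal_union_le (μ := μ) {ω | TerminatesWithin εg εH O n ω}
    {ω | TerminatesWithin εg εH O n ω}ᶜ
  rw [Set.union_compl_self, probReal_univ] at hunion
  linarith

end Termination

section Rescaling

/-- The numerator of `B` over the common denominator `ε`. -/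
noncomputable def rescaledB (L M ε : ℝ) : ℝ := ε + 36 * L ^ 2 / M

/-- The numerator of `C` over the denominator `ε`. -/
noncomputable def rescaledC (L M : ℝ) : ℝ := 9216 * L ^ 2 / M

/-- The ratio `ε² / C_ε`, in a form that is continuous at `ε = 0`. -/
noncomputable def rescaledInvDecrease (L M ε : ℝ) : ℝ :=
  max (6 * L) (9 / 2 * √M * √ε)

/-- The product of `K` and `ε ^ (1 + 2 / (η - 1))`, in a form that is continuous at `ε = 0`. -/
noncomputable def rescaledK (L M Δ δ : ℝ) (η : ℕ) (ε : ℝ) : ℝ :=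
  max (rescaledC L M * Real.log (1 / δ) * ε ^ (2 / ((η : ℝ) - 1)))
    (max (4 * η * rescaledC L M * (Δ * rescaledInvDecrease L M ε) ^ (1 / (η : ℝ)) *
        ε ^ (2 / ((η : ℝ) - 1) - 2 / η))
      (4 * (η : ℝ) ^ 2 * rescaledC L M ^ (1 + 1 / ((η : ℝ) - 1)) *
        rescaledB L M ε ^ (1 / ((η : ℝ) - 1))))

/-- The product of `n` and `ε ^ (2 + 2 / (η - 1))`, in a form that is continuous at `ε = 0`. -/
noncomputable def rescaledN (L M Δ δ : ℝ) (η : ℕ) (ε : ℝ) : ℝ :=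
  2 * (Δ * rescaledInvDecrease L M ε) * ε ^ (2 / ((η : ℝ) - 1)) +
    rescaledB L M ε * rescaledK L M Δ δ η ε

/-- The limit of `n ε ^ (2 + 2 / (η - 1))` as `ε ↓ 0`. -/
noncomputable def limitConst (L M : ℝ) (η : ℕ) : ℝ :=
  rescaledB L M 0 * (4 * (η : ℝ) ^ 2 * rescaledC L M ^ (1 + 1 / ((η : ℝ) - 1)) *
    rescaledB L M 0 ^ (1 / ((η : ℝ) - 1)))

variable {L M Δ δ ε : ℝ} {η : ℕ}

theorem rescaledB_pos (hL : 0 < L) (hM : 0 < M) (hε : 0 ≤ ε) : 0 < rescaledB L M ε := by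
  rw [rescaledB]
  positivity

theorem rescaledC_pos (hL : 0 < L) (hM : 0 < M) : 0 < rescaledC L M := by
  rw [rescaledC]
  positivity

theorem rescaledInvDecrease_pos (hL : 0 < L) : 0 < rescaledInvDecrease L M ε :=
  lt_max_of_lt_left (by positivity)

theorem rescaledInvDecrease_le_of_le {ε' : ℝ} (h : ε ≤ ε') :
    rescaledInvDecrease L M ε ≤ rescaledInvDecrease L M ε' := by
  unfold rescaledInvDecrease
  gcongr

theorem rescaledInvDecrease_sq (hL : 0 ≤ L) (hM : 0 ≤ M) (hε : 0 ≤ ε) :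
    rescaledInvDecrease L M ε ^ 2 = max (36 * L ^ 2) (81 / 4 * M * ε) := by
  have hmono : MonotoneOn (fun y : ℝ => y ^ 2) (Set.Ici 0) := pow_left_monotoneOn
  have hmax := hmono.map_max (a := 6 * L) (b := 9 / 2 * √M * √ε)
    (Set.mem_Ici.2 (by positivity)) (Set.mem_Ici.2 (by positivity))
  rw [rescaledInvDecrease, hmax, mul_pow, mul_pow, mul_pow, Real.sq_sqrt hM, Real.sq_sqrt hε]
  norm_num

theorem longB_eq_rescaledB_div (hε : ε ≠ 0) : longB L M ε = rescaledB L M ε / ε := by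
  rw [longB, constB, rescaledB, add_div, div_self hε, div_div]
  ring

theorem longC_eq_rescaledC_div (hM : 0 < M) (hε : 0 < ε) : longC L M ε = rescaledC L M / ε := by
  have hsqrt : √(ε * M) ^ 6 = (ε * M) ^ 3 := by
    rw [pow_mul _ 2 3, Real.sq_sqrt (by positivity)]
  rw [longC, constC, hsqrt, rescaledC]
  field

theorem decrease_sqrt_eq (hL : 0 < L) (hM : 0 < M) (hε : 0 < ε) :
    decrease L M ε √(ε * M) = ε ^ 2 / rescaledInvDecrease L M ε := by
  have hcubic : 2 * √(ε * M) ^ 3 / (9 * M ^ 2) = ε ^ 2 / (9 / 2 * √M * √ε) := by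
    rw [Real.sqrt_mul hε.le, div_eq_div_iff (by positivity) (by positivity)]
    have hsq_ε := Real.sq_sqrt hε.le
    have hsq_M := Real.sq_sqrt hM.le
    calc 2 * (√ε * √M) ^ 3 * (9 / 2 * √M * √ε) = 9 * (√ε ^ 2) ^ 2 * (√M ^ 2) ^ 2 := by ring
      _ = ε ^ 2 * (9 * M ^ 2) := by rw [hsq_ε, hsq_M]; ring
  have hanti : AntitoneOn (fun y : ℝ => ε ^ 2 / y) (Set.Ioi 0) := fun y hy z _ hyz =>
    div_le_div_of_nonneg_left (sq_nonneg ε) hy hyz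
  rw [decrease, hcubic, rescaledInvDecrease]
  exact (hanti.map_max (Set.mem_Ioi.2 (by positivity)) (Set.mem_Ioi.2 (by positivity))).symm

theorem noiseBound_div_decrease_sq_le (hL : 0 < L) (hM : 0 < M) (hε : 0 < ε) :
    8 * (noiseBound M (2 * L) ε / decrease L M ε √(ε * M)) ^ 2 ≤ longB L M ε * longC L M ε := by
  have hQ : rescaledInvDecrease L M ε ^ 2 ≤ 36 * L ^ 2 + 81 / 4 * M * ε := by
    rw [rescaledInvDecrease_sq hL.le hM.le hε.le]
    exact max_le_add_of_nonneg (by positivity) (by positivity)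
  rw [decrease_sqrt_eq hL hM hε, longB_eq_rescaledB_div hε.ne', longC_eq_rescaledC_div hM hε,
    noiseBound, rescaledB, rescaledC]
  calc 8 * (8 * (2 * L) * ε / (3 * M) / (ε ^ 2 / rescaledInvDecrease L M ε)) ^ 2
      = 2048 * L ^ 2 / (9 * M ^ 2 * ε ^ 2) * rescaledInvDecrease L M ε ^ 2 := by field
    _ ≤ 2048 * L ^ 2 / (9 * M ^ 2 * ε ^ 2) * (36 * L ^ 2 + 81 / 4 * M * ε) := by gcongr
    _ ≤ 2048 * L ^ 2 / (9 * M ^ 2 * ε ^ 2) * (1458 * L ^ 2 + 81 / 2 * M * ε) := by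
        gcongr <;> norm_num
    _ = (ε + 36 * L ^ 2 / M) / ε * (9216 * L ^ 2 / M / ε) := by field

theorem le_longN (hL : 0 < L) (hM : 0 < M) (hε : 0 < ε) :
    2 * (Δ / decrease L M ε √(ε * M)) + longB L M ε * longC L M ε * Real.log (1 / δ) ≤
      longN L M Δ δ η ε := by
  have hB : 0 ≤ longB L M ε := by
    rw [longB_eq_rescaledB_div hε.ne']
    exact div_nonneg (rescaledB_pos hL hM hε.le).le hε.le
  rw [mul_assoc]
  exact add_le_add_right (mul_le_mul_of_nonneg_left (le_max_left _ _) hB) _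

theorem sub_one_pos_of_two_le (hη : 2 ≤ η) : (0 : ℝ) < η - 1 :=
  sub_pos.2 (Nat.one_lt_cast.2 hη)

theorem two_div_lt_two_div_sub_one (hη : 2 ≤ η) : (2 : ℝ) / η < 2 / (η - 1) :=
  div_lt_div_of_pos_left two_pos (sub_one_pos_of_two_le hη) (sub_one_lt _)

theorem longK_mul_rpow_eq (hL : 0 < L) (hM : 0 < M) (hΔ : 0 ≤ Δ) (hε : 0 < ε) :
    longK L M Δ δ η ε * ε ^ (1 + 2 / ((η : ℝ) - 1)) = rescaledK L M Δ δ η ε := by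
  have hB := rescaledB_pos hL hM hε.le
  have hC := rescaledC_pos hL hM
  have hQ := rescaledInvDecrease_pos (M := M) (ε := ε) hL
  have hgap : Δ / decrease L M ε √(ε * M) = Δ * rescaledInvDecrease L M ε / ε ^ (2 : ℝ) := by
    rw [decrease_sqrt_eq hL hM hε, div_div_eq_mul_div, Real.rpow_two]
  have hconstB : constB L M (2 * L) ε = rescaledB L M ε / ε := longB_eq_rescaledB_div hε.ne'
  have hconstC : constC M (2 * L) ε √(ε * M) = rescaledC L M / ε := longC_eq_rescaledC_div hM hε
  rw [longK, constK, hgap, hconstB, hconstC, rescaledK, max_mul_of_nonneg _ _ (by positivity),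
    max_mul_of_nonneg _ _ (by positivity)]
  refine congr_arg₂ max ?_ (congr_arg₂ max ?_ ?_)
  · rw [Real.rpow_add hε, Real.rpow_one]
    field
  · rw [Real.div_rpow (by positivity) (by positivity), ← Real.rpow_mul hε.le, mul_one_div,
      Real.rpow_add hε, Real.rpow_sub hε, Real.rpow_one]
    field
  · rw [Real.div_rpow hC.le hε.le, Real.div_rpow hB.le hε.le,
      show (1 : ℝ) + 2 / ((η : ℝ) - 1) = (1 + 1 / ((η : ℝ) - 1)) + 1 / ((η : ℝ) - 1) by ring,
      Real.rpow_add hε (1 + 1 / ((η : ℝ) - 1))]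
    field

theorem longN_mul_rpow_eq (hL : 0 < L) (hM : 0 < M) (hΔ : 0 ≤ Δ) (hε : 0 < ε) :
    longN L M Δ δ η ε * ε ^ (2 + 2 / ((η : ℝ) - 1)) = rescaledN L M Δ δ η ε := by
  have hn : longN L M Δ δ η ε = 2 * (Δ * rescaledInvDecrease L M ε) / ε ^ 2 +
      rescaledB L M ε / ε * longK L M Δ δ η ε := by
    rw [← longB_eq_rescaledB_div hε.ne', longN, constN, decrease_sqrt_eq hL hM hε,
      div_div_eq_mul_div, longB, longK]
    ring
  rw [hn, rescaledN, ← longK_mul_rpow_eq hL hM hΔ hε, Real.rpow_add hε, Real.rpow_add hε,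
    Real.rpow_one, Real.rpow_two]
  field

theorem continuous_rescaledB (L M : ℝ) : Continuous (rescaledB L M) := by
  unfold rescaledB
  fun_prop

theorem continuous_rescaledInvDecrease (L M : ℝ) : Continuous (rescaledInvDecrease L M) := by
  unfold rescaledInvDecrease
  fun_prop

theorem continuous_rescaledK (L M Δ δ : ℝ) (hη : 2 ≤ η) :
    Continuous (rescaledK L M Δ δ η) := by
  have hη₁ := sub_one_pos_of_two_le hη
  have hexponent := sub_pos.2 (two_div_lt_two_div_sub_one hη)
  have hQ := continuous_rescaledInvDecrease L M
  have hB := continuous_rescaledB L M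
  unfold rescaledK
  refine ((Real.continuous_rpow_const (by positivity)).const_mul _).max
    ((Continuous.mul ?_ (Real.continuous_rpow_const hexponent.le)).max ?_)
  · exact ((hQ.const_mul _).rpow_const fun _ => Or.inr (by positivity)).const_mul _
  · exact (hB.rpow_const fun _ => Or.inr (by positivity)).const_mul _

theorem continuous_rescaledN (L M Δ δ : ℝ) (hη : 2 ≤ η) :
    Continuous (rescaledN L M Δ δ η) := by
  have hη₁ := sub_one_pos_of_two_le hη
  have hQ := continuous_rescaledInvDecrease L M
  exact (((hQ.const_mul _).const_mul _).mul (Real.continuous_rpow_const (by positivity))).add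
    ((continuous_rescaledB L M).mul (continuous_rescaledK L M Δ δ hη))

theorem rescaledN_zero (hL : 0 < L) (hM : 0 < M) (hη : 2 ≤ η) :
    rescaledN L M Δ δ η 0 = limitConst L M η := by
  have hη₁ := sub_one_pos_of_two_le hη
  have hexponent := sub_pos.2 (two_div_lt_two_div_sub_one hη)
  have hB := rescaledB_pos hL hM le_rfl
  have hC := rescaledC_pos hL hM
  rw [rescaledN, rescaledK, Real.zero_rpow (by positivity), Real.zero_rpow hexponent.ne', mul_zero,
    mul_zero, mul_zero, zero_add, max_eq_right (by positivity), max_eq_right (by positivity),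
    limitConst]

theorem rescaledK_nonneg (hL : 0 < L) (hM : 0 < M) (hε : 0 ≤ ε) :
    0 ≤ rescaledK L M Δ δ η ε := by
  have hB := rescaledB_pos hL hM hε
  have hC := rescaledC_pos hL hM
  exact le_max_of_le_right (le_max_of_le_right (by positivity))

theorem rescaledK_le_of_le {ε' : ℝ} (hL : 0 < L) (hM : 0 < M) (hΔ : 0 ≤ Δ) (hη : 2 ≤ η)
    (hδ : 0 ≤ Real.log (1 / δ)) (hε : 0 ≤ ε) (hεε' : ε ≤ ε') :
    rescaledK L M Δ δ η ε ≤ rescaledK L M Δ δ η ε' := by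
  have hη₁ := sub_one_pos_of_two_le hη
  have hexponent := sub_pos.2 (two_div_lt_two_div_sub_one hη)
  have hB := rescaledB_pos hL hM hε
  have hC := rescaledC_pos hL hM
  have hQ := rescaledInvDecrease_pos (M := M) (ε := ε) hL
  have hQ' := rescaledInvDecrease_pos (M := M) (ε := ε') hL
  have hQ_mono := rescaledInvDecrease_le_of_le (L := L) (M := M) hεε'
  have hB_mono : rescaledB L M ε ≤ rescaledB L M ε' := add_le_add_left hεε' _
  unfold rescaledK
  gcongr

theorem rescaledK_one_le (hL : 0 < L) (hM : 0 < M) (hδ : 0 ≤ Real.log (1 / δ)) :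
    rescaledK L M Δ δ η 1 ≤ rescaledC L M * Real.log (1 / δ) + rescaledK L M Δ 1 η 1 := by
  have hC := rescaledC_pos hL hM
  refine max_le ?_ (le_add_of_nonneg_of_le (by positivity) (le_max_right _ _))
  rw [Real.one_rpow, mul_one]
  exact le_add_of_nonneg_right (rescaledK_nonneg hL hM zero_le_one)

theorem exists_rescaledK_le (hL : 0 < L) (hM : 0 < M) (hΔ : 0 ≤ Δ) (hη : 2 ≤ η) :
    ∃ c, 0 < c ∧ ∀ ε, 0 ≤ ε → ε ≤ 1 → ∀ δ, 0 ≤ Real.log (1 / δ) →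
      rescaledK L M Δ δ η ε ≤ c * (1 + Real.log (1 / δ)) := by
  have hC := rescaledC_pos hL hM
  have hK := rescaledK_nonneg (Δ := Δ) (δ := 1) (η := η) hL hM zero_le_one
  refine ⟨rescaledC L M + rescaledK L M Δ 1 η 1, by positivity, fun ε hε₀ hε₁ δ hδ => ?_⟩
  calc rescaledK L M Δ δ η ε ≤ rescaledC L M * Real.log (1 / δ) + rescaledK L M Δ 1 η 1 :=
        (rescaledK_le_of_le hL hM hΔ hη hδ hε₀ hε₁).trans (rescaledK_one_le hL hM hδ)
    _ ≤ (rescaledC L M + rescaledK L M Δ 1 η 1) * (1 + Real.log (1 / δ)) := by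
        linarith [mul_nonneg hK hδ]

theorem exists_rescaledN_le (hL : 0 < L) (hM : 0 < M) (hΔ : 0 ≤ Δ) (hη : 2 ≤ η) :
    ∃ c, 0 < c ∧ ∀ ε, 0 ≤ ε → ε ≤ 1 → ∀ δ, 0 ≤ Real.log (1 / δ) →
      rescaledN L M Δ δ η ε ≤ c * (1 + Real.log (1 / δ)) := by
  obtain ⟨c, hc, hle⟩ := exists_rescaledK_le hL hM hΔ hη
  have hη₁ := sub_one_pos_of_two_le hη
  have hB := rescaledB_pos hL hM zero_le_one
  have hQ := rescaledInvDecrease_pos (M := M) (ε := 1) hL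
  refine ⟨2 * (Δ * rescaledInvDecrease L M 1) + rescaledB L M 1 * c, by positivity,
    fun ε hε₀ hε₁ δ hδ => ?_⟩
  have hgap : 2 * (Δ * rescaledInvDecrease L M ε) * ε ^ (2 / ((η : ℝ) - 1)) ≤
      2 * (Δ * rescaledInvDecrease L M 1) * 1 := by
    have hQ_mono := rescaledInvDecrease_le_of_le (L := L) (M := M) hε₁
    gcongr
    exact Real.rpow_le_one hε₀ hε₁ (by positivity)
  have hbk : rescaledB L M ε * rescaledK L M Δ δ η ε ≤
      rescaledB L M 1 * (c * (1 + Real.log (1 / δ))) :=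
    mul_le_mul (add_le_add_left hε₁ _) (hle ε hε₀ hε₁ δ hδ) (rescaledK_nonneg hL hM hε₀) hB.le
  have hslack : 0 ≤ 2 * (Δ * rescaledInvDecrease L M 1) * Real.log (1 / δ) := by positivity
  calc rescaledN L M Δ δ η ε
      ≤ 2 * (Δ * rescaledInvDecrease L M 1) * 1 +
          rescaledB L M 1 * (c * (1 + Real.log (1 / δ))) := add_le_add hgap hbk
    _ ≤ (2 * (Δ * rescaledInvDecrease L M 1) + rescaledB L M 1 * c) *
          (1 + Real.log (1 / δ)) := by linarith

theorem exists_longK_le_and_longN_le (hL : 0 < L) (hM : 0 < M) (hΔ : 0 ≤ Δ) (hη : 2 ≤ η) :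
    ∃ c, 0 < c ∧ ∀ ε, 0 < ε → ε ≤ 1 → ∀ δ, 0 < δ → δ < 1 →
      longK L M Δ δ η ε ≤ c * (1 + Real.log (1 / δ)) / ε ^ (1 + 2 / ((η : ℝ) - 1)) ∧
      longN L M Δ δ η ε ≤ c * (1 + Real.log (1 / δ)) / ε ^ (2 + 2 / ((η : ℝ) - 1)) := by
  obtain ⟨cK, hcK, hK⟩ := exists_rescaledK_le hL hM hΔ hη
  obtain ⟨cN, -, hN⟩ := exists_rescaledN_le hL hM hΔ hη
  refine ⟨max cK cN, lt_max_of_lt_left hcK, fun ε hε₀ hε₁ δ hδ₀ hδ₁ => ?_⟩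
  have hlog : 0 ≤ Real.log (1 / δ) := Real.log_nonneg (one_lt_one_div hδ₀ hδ₁).le
  rw [le_div_iff₀ (by positivity), le_div_iff₀ (by positivity), longK_mul_rpow_eq hL hM hΔ hε₀,
    longN_mul_rpow_eq hL hM hΔ hε₀]
  exact ⟨(hK ε hε₀.le hε₁ δ hlog).trans (by gcongr; exact le_max_left _ _),
    (hN ε hε₀.le hε₁ δ hlog).trans (by gcongr; exact le_max_right _ _)⟩

theorem tendsto_longK_mul_rpow (hL : 0 < L) (hM : 0 < M) (hΔ : 0 ≤ Δ) (hη : 2 ≤ η) :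
    Tendsto (fun ε => longK L M Δ δ η ε * ε ^ (1 + 2 / ((η : ℝ) - 1))) (𝓝[>] 0)
      (𝓝 (rescaledK L M Δ δ η 0)) :=
  ((continuous_rescaledK L M Δ δ hη).tendsto 0).mono_left nhdsWithin_le_nhds |>.congr'
    (eventually_mem_nhdsWithin.mono fun _ hε => (longK_mul_rpow_eq hL hM hΔ hε).symm)

theorem tendsto_longN_mul_rpow (hL : 0 < L) (hM : 0 < M) (hΔ : 0 ≤ Δ) (hη : 2 ≤ η) :
    Tendsto (fun ε => longN L M Δ δ η ε * ε ^ (2 + 2 / ((η : ℝ) - 1))) (𝓝[>] 0)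
      (𝓝 (limitConst L M η)) := by
  rw [← rescaledN_zero (Δ := Δ) (δ := δ) hL hM hη]
  exact ((continuous_rescaledN L M Δ δ hη).tendsto 0).mono_left nhdsWithin_le_nhds |>.congr'
    (eventually_mem_nhdsWithin.mono fun _ hε => (longN_mul_rpow_eq hL hM hΔ hε).symm)

theorem tendsto_limitConst_atTop (hL : 0 < L) (hM : 0 < M) :
    Tendsto (limitConst L M) atTop atTop := by
  have hB := rescaledB_pos hL hM le_rfl
  have hC := rescaledC_pos hL hM
  have hr : Tendsto (fun η : ℕ => 1 / ((η : ℝ) - 1)) atTop (𝓝 0) := by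
    simp only [one_div, sub_eq_add_neg]
    exact (tendsto_atTop_add_const_right _ _ tendsto_natCast_atTop_atTop).inv_tendsto_atTop
  have hfactor : Tendsto (fun η : ℕ => rescaledB L M 0 * 4 *
      rescaledC L M ^ (1 + 1 / ((η : ℝ) - 1)) * rescaledB L M 0 ^ (1 / ((η : ℝ) - 1))) atTop
      (𝓝 (rescaledB L M 0 * 4 * rescaledC L M ^ (1 + 0 : ℝ) * rescaledB L M 0 ^ (0 : ℝ))) :=
    ((tendsto_const_nhds.rpow (hr.const_add 1) (Or.inl hC.ne')).const_mul _).mul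
      (tendsto_const_nhds.rpow hr (Or.inl hB.ne'))
  have hsq : Tendsto (fun η : ℕ => (η : ℝ) ^ 2) atTop atTop :=
    (tendsto_pow_atTop two_ne_zero).comp tendsto_natCast_atTop_atTop
  refine (hsq.atTop_mul_pos (by positivity) hfactor).congr fun η => ?_
  rw [limitConst]
  ring

end Rescaling

section BigO

variable {F G : ℝ → ℝ} {u v c L M Δ δ : ℝ}

theorem isBigO_one_div_rpow_of_tendsto
    (h : Tendsto (fun ε => F ε * ε ^ u) (𝓝[>] 0) (𝓝 c)) :
    F =O[𝓝[>] 0] fun ε => 1 / ε ^ u := by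
  refine ((h.isBigO_one ℝ).mul (isBigO_refl (fun ε => 1 / ε ^ u) (𝓝[>] 0))).congr'
    ?_ (.of_forall fun ε => one_mul _)
  filter_upwards [self_mem_nhdsWithin] with ε hε
  rw [mul_assoc, mul_one_div_cancel (Real.rpow_pos_of_pos hε u).ne', mul_one]

theorem isBigO_one_div_rpow_of_le (h : u ≤ v) :
    (fun ε : ℝ => 1 / ε ^ u) =O[𝓝[>] 0] fun ε => 1 / ε ^ v := by
  refine IsBigO.of_norm_eventuallyLE ?_
  filter_upwards [Ioc_mem_nhdsGT zero_lt_one] with ε hε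
  have hpow := Real.rpow_pos_of_pos hε.1 v
  rw [Real.norm_of_nonneg (one_div_nonneg.2 (Real.rpow_nonneg hε.1.le u))]
  exact one_div_le_one_div_of_le hpow (Real.rpow_le_rpow_of_exponent_ge hε.1 hε.2 h)

theorem isBigOTilde_of_isBigO {l : Filter ℝ} (h : F =O[l] G) : IsBigOTilde l F G :=
  ⟨0, by simpa only [pow_zero, mul_one] using h⟩

theorem isBigO_longB (L M : ℝ) : longB L M =O[𝓝[>] 0] fun ε => 1 / ε := by
  have hlim : Tendsto (fun ε => longB L M ε * ε ^ (1 : ℝ)) (𝓝[>] 0) (𝓝 (rescaledB L M 0)) :=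
    ((continuous_rescaledB L M).tendsto 0).mono_left nhdsWithin_le_nhds |>.congr' (by
      filter_upwards [self_mem_nhdsWithin] with ε hε
      rw [Real.rpow_one, longB_eq_rescaledB_div hε.ne', div_mul_cancel₀ _ hε.ne'])
  simpa only [Real.rpow_one] using isBigO_one_div_rpow_of_tendsto hlim

theorem isBigO_longC (L : ℝ) (hM : 0 < M) : longC L M =O[𝓝[>] 0] fun ε => 1 / ε := by
  refine (isBigO_refl (fun ε : ℝ => 1 / ε) _).const_mul_left (rescaledC L M) |>.congr' ?_ .rfl
  filter_upwards [self_mem_nhdsWithin] with ε hε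
  rw [longC_eq_rescaledC_div hM hε, mul_one_div]

theorem exists_isBigOTilde_longN (hL : 0 < L) (hM : 0 < M) (hΔ : 0 ≤ Δ) {κ : ℝ} (hκ : 0 < κ) :
    ∃ η₀ : ℕ, ∀ η, η₀ ≤ η → ∀ δ,
      IsBigOTilde (𝓝[>] 0) (longN L M Δ δ η) fun ε => 1 / ε ^ (2 + κ) := by
  refine ⟨⌈2 / κ⌉₊ + 2, fun η hη δ => isBigOTilde_of_isBigO ?_⟩
  have hη₂ : 2 ≤ η := (Nat.le_add_left 2 _).trans hη
  have hη₁ := sub_one_pos_of_two_le hη₂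
  have hcast : (⌈2 / κ⌉₊ + 2 : ℝ) ≤ η := by exact_mod_cast hη
  have hκη : 2 / ((η : ℝ) - 1) ≤ κ := by
    rw [div_le_comm₀ hη₁ hκ]
    linarith [Nat.le_ceil (2 / κ)]
  exact (isBigO_one_div_rpow_of_tendsto (tendsto_longN_mul_rpow hL hM hΔ hη₂)).trans
    (isBigO_one_div_rpow_of_le (by linarith))

theorem isBigOTilde_longK_eleven (hL : 0 < L) (hM : 0 < M) (hΔ : 0 ≤ Δ) :
    IsBigOTilde (𝓝[>] 0) (longK L M Δ δ 11) fun ε => 1 / ε ^ (1.2 : ℝ) := by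
  refine isBigOTilde_of_isBigO (isBigO_one_div_rpow_of_tendsto (c := rescaledK L M Δ δ 11 0) ?_)
  convert tendsto_longK_mul_rpow hL hM hΔ (by norm_num : 2 ≤ 11) using 4
  norm_num

theorem isBigOTilde_longN_eleven (hL : 0 < L) (hM : 0 < M) (hΔ : 0 ≤ Δ) :
    IsBigOTilde (𝓝[>] 0) (longN L M Δ δ 11) fun ε => 1 / ε ^ (2.2 : ℝ) := by
  refine isBigOTilde_of_isBigO (isBigO_one_div_rpow_of_tendsto (c := limitConst L M 11) ?_)
  convert tendsto_longN_mul_rpow hL hM hΔ (by norm_num : 2 ≤ 11) using 4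
  norm_num

end BigO

end InexactNC

open InexactNC in
theorem mainTheorem4_general (L M : ℝ) (hL : 0 < L) (hM : 0 < M) :
    (∀ (d : ℕ) (f : E d → ℝ) (D : Set (E d)) (fbar : ℝ),
      BasicAssumption f D L M fbar →
      ∀ (x₀ : E d) (ε : ℝ), 0 < ε →
      ∀ (Ω : Type*) (mΩ : MeasurableSpace Ω) (μ : Measure Ω), IsProbabilityMeasure μ →
      ∀ (ℱ : Filtration ℕ mΩ) (σ : ℕ → Ω → ℝ) (O : Oracle d Ω),
        RandomSigns μ ℱ σ → O.Nonanticipating ℱ →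
        (∀ᵐ ω ∂μ, WeakInexactness f D ε √(ε * M) O
          (iterate L M ε √(ε * M) x₀ O (fun k ω => |O.lam k ω|) σ) ω) →
        (∀ᵐ ω ∂μ, AdmissibleStepsizes (2 * L) ε √(ε * M) O
          (fun k ω => |O.lam k ω|) ω) ∧
        ∀ (δ : ℝ), 0 < δ → δ < 1 → ∀ (n : ℝ),
          2 * ((f x₀ - fbar) / decrease L M ε √(ε * M)) +
            longB L M ε * longC L M ε * Real.log (1 / δ) ≤ n →
          1 - δ ≤ μ.real {ω | TerminatesWithin ε √(ε * M) O n ω}) ∧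
    (longB L M =O[𝓝[>] 0] fun ε : ℝ => 1 / ε) ∧
    (longC L M =O[𝓝[>] 0] fun ε : ℝ => 1 / ε) ∧
    ∀ (Δ : ℝ), 0 ≤ Δ →
      (∀ (δ : ℝ), 0 < δ → δ < 1 →
        IsBigOTilde (𝓝[>] 0) (longK L M Δ δ 11)
          (fun ε => 1 / ε ^ (1.2 : ℝ)) ∧
        IsBigOTilde (𝓝[>] 0) (longN L M Δ δ 11)
          (fun ε => 1 / ε ^ (2.2 : ℝ))) ∧
      (∀ (η : ℕ), 2 ≤ η → ∃ c : ℝ, 0 < c ∧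
        ∀ (ε : ℝ), 0 < ε → ε ≤ 1 → ∀ (δ : ℝ), 0 < δ → δ < 1 →
          longK L M Δ δ η ε ≤
            c * (1 + Real.log (1 / δ)) / ε ^ (1 + 2 / ((η : ℝ) - 1)) ∧
          longN L M Δ δ η ε ≤
            c * (1 + Real.log (1 / δ)) / ε ^ (2 + 2 / ((η : ℝ) - 1))) ∧
      (∀ (κ : ℝ), 0 < κ → ∃ η₀ : ℕ, ∀ (η : ℕ), η₀ ≤ η → ∀ (δ : ℝ), 0 < δ → δ < 1 →
        IsBigOTilde (𝓝[>] 0) (longN L M Δ δ η)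
          (fun ε => 1 / ε ^ (2 + κ))) ∧
      (∃ c : ℕ → ℝ, Tendsto c atTop atTop ∧
        ∀ (η : ℕ), 2 ≤ η → ∀ (δ : ℝ), 0 < δ → δ < 1 →
          Tendsto (fun ε : ℝ => longN L M Δ δ η ε *
            ε ^ (2 + 2 / ((η : ℝ) - 1))) (𝓝[>] 0) (𝓝 (c η))) := by
  refine ⟨fun d f D fbar h x₀ ε hε Ω mΩ μ hμ ℱ σ O hσ hO hω => ?_, isBigO_longB L M,
    isBigO_longC L hM, fun Δ hΔ => ⟨fun δ _ _ =>
      ⟨isBigOTilde_longK_eleven hL hM hΔ, isBigOTilde_longN_eleven hL hM hΔ⟩,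
    fun η hη => exists_longK_le_and_longN_le hL hM hΔ hη, fun κ hκ => ?_,
    limitConst L M, tendsto_limitConst_atTop hL hM,
    fun η hη δ _ _ => tendsto_longN_mul_rpow hL hM hΔ hη⟩⟩
  · have hεH : 0 < √(ε * M) := by positivity
    have ha := hω.mono fun ω hω => hω.admissibleStepsizes_abs_lam h hL.le hεH.le
    refine ⟨ha, fun δ hδ₀ hδ₁ n hn => ?_⟩
    have hlog : 0 ≤ Real.log (1 / δ) := Real.log_nonneg (one_lt_one_div hδ₀ hδ₁).le
    refine h.le_measureReal_terminatesWithin hL hM hε hεH (by positivity) hσ hO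
      (fun k => (hO.lam k).norm) hω ha hδ₀ hδ₁ (le_trans ?_ hn)
    exact add_le_add_right
      (mul_le_mul_of_nonneg_right (noiseBound_div_decrease_sq_le hL hM hε) hlog) _
  · obtain ⟨η₀, hη₀⟩ := exists_isBigOTilde_longN hL hM hΔ hκ
    exact ⟨η₀, fun η hη δ _ _ => hη₀ η hη δ⟩

theorem mainTheorem4 (L M : ℝ) (hL : 0 < L) (hM : 0 < M) :
    -- the run with stepsizes `|lam k|`: the bound `α = 2L` is admissible, and the algorithm
    -- terminates within `n` iterations with probability at least `1 - δ`
    (∀ (d : ℕ) (f : InexactNC.E d → ℝ) (D : Set (InexactNC.E d)) (fbar : ℝ),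
      InexactNC.BasicAssumption f D L M fbar →
      ∀ (x₀ : InexactNC.E d) (ε : ℝ), 0 < ε →
      ∀ (Ω : Type*) (mΩ : MeasurableSpace Ω) (μ : Measure Ω), IsProbabilityMeasure μ →
      ∀ (ℱ : Filtration ℕ mΩ) (σ : ℕ → Ω → ℝ) (O : InexactNC.Oracle d Ω),
        InexactNC.RandomSigns μ ℱ σ → O.Nonanticipating ℱ →
        (∀ᵐ ω ∂μ, InexactNC.InexactnessAssumption f D ε (Real.sqrt (ε * M)) O
          (InexactNC.iterate L M ε (Real.sqrt (ε * M)) x₀ O (fun k ω => |O.lam k ω|) σ) ω) →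
        (∀ᵐ ω ∂μ, ∀ k, InexactNC.Reached ε (Real.sqrt (ε * M)) O k ω →
          InexactNC.NegCurvStep ε (Real.sqrt (ε * M)) O k ω →
          |O.lam k ω| ∈ Set.Icc (Real.sqrt (ε * M)) (min (2 * L) |O.lam k ω|)) ∧
        ∀ (δ : ℝ), 0 < δ → δ < 1 → ∀ (η : ℕ), 2 ≤ η →
          1 - δ ≤ μ.real {ω | InexactNC.TerminatesWithin ε (Real.sqrt (ε * M)) O
            (InexactNC.longN L M (f x₀ - fbar) δ η ε) ω}) ∧
    -- `B = O(1/ε)` and `C = O(1/ε)`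
    (InexactNC.longB L M =O[𝓝[>] 0] fun ε : ℝ => 1 / ε) ∧
    (InexactNC.longC L M =O[𝓝[>] 0] fun ε : ℝ => 1 / ε) ∧
    -- the size of `K` and `n`, where `Δ` stands for `f x₀ - fbar`
    ∀ (Δ : ℝ), 0 ≤ Δ →
      -- `η = 11`
      (∀ (δ : ℝ), 0 < δ → δ < 1 →
        InexactNC.IsBigOTilde (𝓝[>] 0) (InexactNC.longK L M Δ δ 11)
          (fun ε => 1 / ε ^ (1.2 : ℝ)) ∧
        InexactNC.IsBigOTilde (𝓝[>] 0) (InexactNC.longN L M Δ δ 11)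
          (fun ε => 1 / ε ^ (2.2 : ℝ))) ∧
      -- every `η`, with the dependence on `δ` explicit (for `η = 11`: exponents 1.2 and 2.2)
      (∀ (η : ℕ), 2 ≤ η → ∃ c : ℝ, 0 < c ∧
        ∀ (ε : ℝ), 0 < ε → ε ≤ 1 → ∀ (δ : ℝ), 0 < δ → δ < 1 →
          InexactNC.longK L M Δ δ η ε ≤
            c * (1 + Real.log (1 / δ)) / ε ^ (1 + 2 / ((η : ℝ) - 1)) ∧
          InexactNC.longN L M Δ δ η ε ≤
            c * (1 + Real.log (1 / δ)) / ε ^ (2 + 2 / ((η : ℝ) - 1))) ∧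
      -- a large `η` brings the exponent as close to 2 as desired
      (∀ (κ : ℝ), 0 < κ → ∃ η₀ : ℕ, ∀ (η : ℕ), η₀ ≤ η → ∀ (δ : ℝ), 0 < δ → δ < 1 →
        InexactNC.IsBigOTilde (𝓝[>] 0) (InexactNC.longN L M Δ δ η)
          (fun ε => 1 / ε ^ (2 + κ))) ∧
      -- at the expense of a larger constant factor
      (∃ c : ℕ → ℝ, Tendsto c atTop atTop ∧
        ∀ (η : ℕ), 2 ≤ η → ∀ (δ : ℝ), 0 < δ → δ < 1 →
          Tendsto (fun ε : ℝ => InexactNC.longN L M Δ δ η ε *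
            ε ^ (2 + 2 / ((η : ℝ) - 1))) (𝓝[>] 0) (𝓝 (c η))) := by
  have hgeneral := mainTheorem4_general L M hL hM
  refine ⟨fun d f D fbar h x₀ ε hε Ω mΩ μ hμ ℱ σ O hσ hO hω => ?_, hgeneral.2⟩
  obtain ⟨ha, hterminates⟩ := hgeneral.1 d f D fbar h x₀ ε hε Ω mΩ μ hμ ℱ σ O hσ hO
    (hω.mono fun _ hω => hω.weakInexactness)
  exact ⟨ha, fun δ hδ₀ hδ₁ η _ => hterminates δ hδ₀ hδ₁ _ (InexactNC.le_longN hL hM hε)⟩
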